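/- **Theorem (Fast rate).** There is a universal constant $C>0$ such that the following holds. Let $\mathcal X$ be a measurable space and let $P_1,P_2,\dots$ be probability distributions of pairs $(x,y)\in\mathcal X\times\mathbb R$ such that, for some $M_0>0$, $|y|\le M_0$ almost surely under every $P_j$, and such that all $P_j$ have the same marginal distribution $\mathcal P$ of the covariate $x$. Let $f_1,f_2:\mathcal X\to\mathbb R$ be measurable with $|f_1|,|f_2|\le M_0$. Let $t\ge1$ and let $B_1,B_2,\dots\ge1$ be integers. One observes independent samples $z_{j,i}\sim P_j$, $1\le j\le t$, $1\le i\le B_j$. Let $\ell(f,(x,y))=(f(x)-y)^2$ and $L_t(f)=\mathbb E_{z\sim P_t}\,\ell(f,z)$; let $f_j^*(x)=\mathbb E[y\mid x]$ be the regression function of $P_j$, let $\|h\|_{\mathcal P}=(\mathbb E_{x\sim\mathcal P}h(x)^2)^{1/2}$, and let $B_{t,k}=\sum_{j=t-k+1}^tB_j$. *Algorithm (pairwise comparison with adaptive rolling window; hyperparameters $\delta'$ and $M$).* Put $u_{j,i}=\ell(f_1,z_{j,i})-\ell(f_2,z_{j,i})$ and, for $1\le k\le t$, $$\widehat\mu_{t,k}=\frac1{B_{t,k}}\sum_{j=t-k+1}^t\sum_{i=1}^{B_j}u_{j,i},\qquad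 \widehat v_{t,k}^2=\frac1{B_{t,k}-1}\sum_{j=t-k+1}^t\sum_{i=1}^{B_j}(u_{j,i}-\widehat\mu_{t,k})^2 ,$$ $$\widehat\psi(k)=\begin{cases}M,&B_{t,k}=1,\\ \widehat v_{t,k}\sqrt{\dfrac{2\log(2/\delta')}{B_{t,k}}}+\dfrac{8M\log(2/\delta')}{3(B_{t,k}-1)},&B_{t,k}\ge2,\end{cases}$$ $$\widehat\phi(k)=\max_{1\le i\le k}\big(|\widehat\mu_{t,k}-\widehat\mu_{t,i}|-[\widehat\psi(k)+\widehat\psi(i)]\big)_+ .$$ Choose any $\widehat k$ minimizing $\widehat\phi(k)+\widehat\psi(k)$ over $1\le k\le t$; output $\widehat f=f_1$ if $\widehat\mu_{t,\widehat k}\le0$ and $\widehat f=f_2$ otherwise. Let $\delta\in(0,1)$ and run the algorithm with $\delta'=\delta/(3t)$ and $M=8M_0^2$ (the length of the interval $[-4M_0^2,4M_0^2]$ that contains the $u_{j,i}$). Then, with probability at least $1-\delta$, for every admissible choice of $\widehat k$, $$\|\widehat f-f_t^*\|_{\mathcal P}-\min_{r\in\{1,2\}}\|f_r-f_t^*\|_{\mathcal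 P}\le C\sqrt{\log(6t/\delta)}\,\min_{1\le k\le t}\Big\{\max_{t-k+1\le j\le t}\|f_j^*-f_t^*\|_{\mathcal P}+\frac{M_0}{\sqrt{B_{t,k}}}\Big\}$$ and, on the same event, the excess risk satisfies $$L_t(\widehat f)-L_t(f_t^*)\le 2\min_{r\in\{1,2\}}\big[L_t(f_r)-L_t(f_t^*)\big]+C\log(6t/\delta)\min_{1\le k\le t}\Big\{\max_{t-k+1\le j\le t}\|f_j^*-f_t^*\|_{\mathcal P}^2+\frac{M_0^2}{B_{t,k}}\Big\}.$$ -/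

import Mathlib

open MeasureTheory ProbabilityTheory

noncomputable section

namespace RollingWindow

/-! ### Adaptive rolling window for mean estimation

The data `u j i` are indexed by the period `j ∈ {1, …, t}` and the sample index
`i ∈ {1, …, B j}`, where `B j` is the batch size. The window of length `k ∈ {1, …, t}` consists of
the periods `t - k + 1, …, t`. -/

/-- `B_{t,k}`: the number of samples in the `k` most recent periods. -/
def windowSize (B : ℕ → ℕ) (t k : ℕ) : ℕ :=
  ∑ j ∈ Finset.Icc (t - k + 1) t, B j

/-- `μ̂_{t,k}`: the sample mean over the window. -/
def windowMean (B : ℕ → ℕ) (u : ℕ → ℕ → ℝ) (t k : ℕ) : ℝ :=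
  (∑ j ∈ Finset.Icc (t - k + 1) t, ∑ i ∈ Finset.Icc 1 (B j), u j i) / (windowSize B t k : ℝ)

/-- `v̂²_{t,k}`: the sample variance over the window (only used when `B_{t,k} ≥ 2`). -/
def windowVar (B : ℕ → ℕ) (u : ℕ → ℕ → ℝ) (t k : ℕ) : ℝ :=
  (∑ j ∈ Finset.Icc (t - k + 1) t, ∑ i ∈ Finset.Icc 1 (B j), (u j i - windowMean B u t k) ^ 2) /
    ((windowSize B t k : ℝ) - 1)

/-- `ψ̂(t,k,δ)`: the empirical proxy for the stochastic error. -/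
def psiHat (B : ℕ → ℕ) (u : ℕ → ℕ → ℝ) (M δ : ℝ) (t k : ℕ) : ℝ :=
  if windowSize B t k = 1 then M
  else √(windowVar B u t k) * √(2 * Real.log (2 / δ) / (windowSize B t k : ℝ)) +
    8 * M * Real.log (2 / δ) / (3 * ((windowSize B t k : ℝ) - 1))

/-- `φ̂(t,k,δ)`: the empirical proxy for the bias, a maximum over `i ∈ {1, …, k}` of positive
parts. -/
def phiHat (B : ℕ → ℕ) (u : ℕ → ℕ → ℝ) (M δ : ℝ) (t k : ℕ) : ℝ :=
  ⨆ i : Set.Icc 1 k,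
    max (|windowMean B u t k - windowMean B u t i| - (psiHat B u M δ t k + psiHat B u M δ t i)) 0

/-- `k` is a window that the mean estimation algorithm may choose: a minimizer of
`φ̂(t,k,δ) + ψ̂(t,k,δ)` over `k ∈ {1, …, t}`. -/
def IsAdaptiveWindow (B : ℕ → ℕ) (u : ℕ → ℕ → ℝ) (M δ : ℝ) (t k : ℕ) : Prop :=
  k ∈ Set.Icc 1 t ∧ ∀ k' ∈ Set.Icc 1 t,
    phiHat B u M δ t k + psiHat B u M δ t k ≤ phiHat B u M δ t k' + psiHat B u M δ t k'

/-! ### Regression with square loss and model comparison -/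

variable {X : Type*}

/-- The square loss `ℓ(f,(x,y)) = (f x - y)²`. -/
def sqLoss (f : X → ℝ) (z : X × ℝ) : ℝ := (f z.1 - z.2) ^ 2

/-- `fhat` is a possible output of the pairwise comparison algorithm on the models `f₁`, `f₂`, the
data `z j i` and hyperparameters `δ`, `M`: the mean estimation algorithm is run on the loss
differences, with any admissible choice of the window, and `f₁` is returned if the estimate is
nonpositive, `f₂` otherwise. -/
def IsComparisonOutput (f₁ f₂ : X → ℝ) (B : ℕ → ℕ) (z : ℕ → ℕ → X × ℝ) (M δ : ℝ) (t : ℕ)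
    (fhat : X → ℝ) : Prop :=
  ∃ k, IsAdaptiveWindow B (fun j i => sqLoss f₁ (z j i) - sqLoss f₂ (z j i)) M δ t k ∧
    ((windowMean B (fun j i => sqLoss f₁ (z j i) - sqLoss f₂ (z j i)) t k ≤ 0 ∧ fhat = f₁) ∨
      (0 < windowMean B (fun j i => sqLoss f₁ (z j i) - sqLoss f₂ (z j i)) t k ∧ fhat = f₂))

variable [MeasurableSpace X]

/-- The risk (generalization error) of `f` under the distribution `P`, for the square loss. -/
def risk (P : Measure (X × ℝ)) (f : X → ℝ) : ℝ := ∫ z, sqLoss f z ∂P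

/-- The regression function `x ↦ 𝔼[y | x]` of a distribution `P` of `(x, y)`: the mean of the
regular conditional distribution of `y` given `x`. -/
def regressionFn (P : Measure (X × ℝ)) [IsFiniteMeasure P] (x : X) : ℝ := ∫ y, y ∂(P.condKernel x)

/-- The `L²` norm `‖h‖_Q = (𝔼_{x ∼ Q} h(x)²)^{1/2}`. -/
def normL2 (Q : Measure X) (h : X → ℝ) : ℝ := √(∫ x, h x * h x ∂Q)

/-- The distribution shift `max_{t-k+1 ≤ j ≤ t} ‖f_j^* - f_t^*‖_Q` over the window of length `k`,
where `f_j^*` is the regression function of `P j`. -/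
def maxShift (P : ℕ → Measure (X × ℝ)) [∀ j, IsProbabilityMeasure (P j)] (Q : Measure X)
    (t k : ℕ) : ℝ :=
  ⨆ j : Set.Icc (t - k + 1) t, normL2 Q (fun x => regressionFn (P j) x - regressionFn (P t) x)

end RollingWindow

end

namespace RollingWindow

/-! ### Scalar inequalities for the exponential -/

/-! Let `d₁`, `d₂` be the distances of the models to the current regression function and `H = ‖f₁ -
f₂‖`. The loss difference `u` has current mean `d₁² - d₂²`, and the algorithm only needs its sign.
The rate is fast because both sources of error scale with `H`. Since the covariate marginal is
fixed, the mean of `u` in period `j` differs from the current one by `-2⟨f₁ - f₂, f_j^* - f_t^*⟩`,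
at most `2H` times the shift. Since `u` is `f₁ - f₂` times a factor bounded by `4M₀`, its second
moment is at most `16M₀²H²`, so the stochastic error is of order `M₀H√a + M₀²a` with `a =
log(6t/δ)/B_{t,k}`.

With `H ≤ 2(d₁ + d₂)` and `R = shift + √a M₀`, the estimate is off by at most a multiple of `(d₁ +
d₂)R + R²`. If the worse model is selected, `d₁² - d₂² = (d₁ - d₂)(d₁ + d₂)` is bounded in this way
up to sign; dividing by `d₁ + d₂` leaves a gap of order `R` (`sub_min_le_and_sq_le`).

The window is chosen without knowing shift or variance. `empirical_bernstein_unit` shows that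
`psiHat` dominates the deviation in a fixed window and, conversely, is not much larger than the
population error (`le_psiHat_le`, `measureReal_window_le`). On the event where this holds in all `t`
windows, the deterministic oracle inequality `abs_windowMean_sub_le` makes the adaptive window as
good as any fixed one, up to constants. -/

lemma hasSum_exp_sub_one_sub_id (x : ℝ) :
    HasSum (fun n : ℕ => x ^ (n + 2) / ((n + 2).factorial : ℝ)) (Real.exp x - 1 - x) := by
  have h := NormedSpace.expSeries_div_hasSum_exp x
  rw [← Real.exp_eq_exp_ℝ] at h
  have h2 := (hasSum_nat_add_iff' 2).2 h
  simpa [Finset.sum_range_succ, sub_sub] using h2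

/-- Termwise comparison of power series: `x ^ (n + 2) ≤ x ^ 2` when `|x| ≤ 1`. -/
lemma exp_mul_le_one_add_mul_add_sq_mul {l x : ℝ} (hl : 0 ≤ l) (hx : |x| ≤ 1) :
    Real.exp (l * x) ≤ 1 + l * x + x ^ 2 * (Real.exp l - 1 - l) := by
  have h1 := hasSum_exp_sub_one_sub_id (l * x)
  have h2 := (hasSum_exp_sub_one_sub_id l).mul_left (x ^ 2)
  have h : Real.exp (l * x) - 1 - l * x ≤ x ^ 2 * (Real.exp l - 1 - l) := by
    refine hasSum_le (fun n => ?_) h1 h2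
    have hxn : x ^ n ≤ 1 := (le_abs_self _).trans (by rw [abs_pow]; exact pow_le_one₀ (abs_nonneg _) hx)
    rw [← mul_div_assoc]
    gcongr
    rw [mul_pow, pow_add x n 2]
    have := mul_le_mul_of_nonneg_left hxn (by positivity : 0 ≤ l ^ (n + 2) * x ^ 2)
    linarith
  linarith

lemma two_mul_three_pow_le_factorial (n : ℕ) : 2 * 3 ^ n ≤ (n + 2).factorial := by
  induction n with
  | zero => decide
  | succ n ih =>
    rw [show n + 1 + 2 = (n + 2) + 1 by ring, Nat.factorial_succ, pow_succ]
    nlinarith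

/-- The bound `2 * 3 ^ n ≤ (n + 2)!` dominates the exponential tail by a geometric series of ratio
`l / 3`. -/
lemma exp_sub_one_sub_id_le {l : ℝ} (hl : 0 ≤ l) (hl3 : l < 3) :
    Real.exp l - 1 - l ≤ l ^ 2 / (2 * (1 - l / 3)) := by
  have h2 : HasSum (fun n : ℕ => l ^ 2 / 2 * (l / 3) ^ n) (l ^ 2 / 2 * (1 - l / 3)⁻¹) :=
    (hasSum_geometric_of_lt_one (by positivity) (by linarith)).mul_left _
  refine (hasSum_le (fun n => ?_) (hasSum_exp_sub_one_sub_id l) h2).trans_eq ?_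
  · have h : (2 * 3 ^ n : ℝ) ≤ ((n + 2).factorial : ℝ) := by
      exact_mod_cast two_mul_three_pow_le_factorial n
    calc l ^ (n + 2) / ((n + 2).factorial : ℝ) ≤ l ^ (n + 2) / (2 * 3 ^ n : ℝ) := by gcongr
      _ = _ := by rw [div_pow, pow_add]; field_simp
  · rw [← div_eq_mul_inv, div_div]

lemma exp_mul_le_one_add_mul_exp_sub_one (l : ℝ) {x : ℝ} (h0 : 0 ≤ x) (h1 : x ≤ 1) :
    Real.exp (l * x) ≤ 1 + x * (Real.exp l - 1) := by
  have h := convexOn_exp.2 (Set.mem_univ l) (Set.mem_univ 0) h0 (by linarith : 0 ≤ 1 - x) (by ring)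
  simp only [smul_eq_mul, mul_zero, add_zero, Real.exp_zero] at h
  rw [mul_comm l x]
  linarith

/-- `(1 + l + l²/2)(1 - l + l²/2) = 1 + l⁴/4 ≥ 1`, and the first factor is at most `exp l`. -/
lemma exp_neg_le_one_sub_add_sq_div_two {l : ℝ} (hl : 0 ≤ l) :
    Real.exp (-l) ≤ 1 - l + l ^ 2 / 2 := by
  have h1 := Real.quadratic_le_exp_of_nonneg hl
  rw [Real.exp_neg, inv_le_iff_one_le_mul₀ (Real.exp_pos l)]
  have h3 : 0 ≤ 1 - l + l ^ 2 / 2 := by nlinarith [sq_nonneg (l - 1)]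
  nlinarith [mul_le_mul_of_nonneg_left h1 h3, sq_nonneg (l ^ 2)]

/-! ### Deterministic core of the empirical Bernstein inequality -/

/-- Here `q = √(2a)`, `s` and `w` are the population and empirical standard deviations, and `D` is
the deviation of the mean. `hD` is Bernstein's bound; `hlow` and `hmid` are lower tails for the
average square about the true mean, which equals `w² + D²`. Eliminating `s` yields a bound in `w`
alone. -/
lemma empirical_bernstein_core {q s w D : ℝ} (hq : 0 < q) (hs2 : s ≤ 1 / 2)
    (hw : 0 ≤ w) (hD : D ≤ q * s + q ^ 2 / 6)
    (hlow : q ^ 2 < 7 / 64 → s ^ 2 - q * s ≤ w ^ 2 + D ^ 2)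
    (hmid : 7 / 64 ≤ q ^ 2 → 63 / 100 * s ^ 2 - q ^ 2 / 2 ≤ w ^ 2 + D ^ 2) :
    D ≤ q * w + 4 * q ^ 2 / 3 := by
  by_contra! hc
  have hqs : q * s ≤ q / 2 := by nlinarith
  have hqw : 0 ≤ q * w := by positivity
  have hD1 : 4 * q ^ 2 / 3 < D := by linarith
  have hqw2 : q ^ 2 * w ^ 2 ≤ (D - 4 * q ^ 2 / 3) ^ 2 := by
    rw [← mul_pow]
    exact pow_le_pow_left₀ hqw (by linarith) 2
  -- In the first case the inequalities below add up to a positive multiple of `q²(q² - 7/64) ≥ 0`,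
  -- so `7/64` is exactly where this argument stops working.
  by_cases h7 : q ^ 2 < 7 / 64
  · have hl := hlow h7
    have hq1 : q < 2 / 3 := by nlinarith
    have hDle : D ≤ 1 := by nlinarith
    have e1 : (D - 2 * q ^ 2 / 3) ^ 2 ≤ (q * (s - q / 2)) ^ 2 :=
      pow_le_pow_left₀ (by nlinarith) (by nlinarith) 2
    have e2 := mul_le_mul_of_nonneg_left hl (sq_nonneg q)
    have e3 : 0 ≤ q ^ 2 * (19 * q ^ 2 / 12 + D ^ 2 - 4 * D / 3) := by linarith
    have e4 : 0 ≤ 19 * q ^ 2 / 12 + D ^ 2 - 4 * D / 3 := by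
      rwa [mul_nonneg_iff_of_pos_left (by positivity)] at e3
    have e5 : 0 ≤ (D - 4 * q ^ 2 / 3) * (1 - D) := mul_nonneg (by linarith) (by linarith)
    have e6 : 0 ≤ (D - 4 * q ^ 2 / 3) * (1 / 3 - 4 * q ^ 2 / 3) :=
      mul_nonneg (by linarith) (by linarith)
    have e7 : 0 < q ^ 2 * (7 / 64 - q ^ 2) := mul_pos (by positivity) (by linarith)
    linarith
  · push Not at h7
    have hl := hmid h7
    -- For `q ≥ 3/7` the claim follows from `D ≤ q/2 + q²/6 ≤ 4q²/3` alone. Only a short interval of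
    -- `q` is left, where the cruder lower tail suffices.
    have hq37 : q < 3 / 7 := by
      by_contra! h
      nlinarith
    have hq33 : 33 / 100 ≤ q := by
      by_contra! h
      nlinarith
    have hp : q ^ 2 ≤ 9 / 49 := by nlinarith
    have hDp : D ≤ 4 * q ^ 2 / 3 + 35 / 100 * q ^ 2 := by nlinarith
    have e1 : (D - q ^ 2 / 6) ^ 2 ≤ (q * s) ^ 2 :=
      pow_le_pow_left₀ (by linarith [sq_nonneg q]) (by linarith) 2
    have e2 := mul_le_mul_of_nonneg_left hl (sq_nonneg q)
    have hp0 : 0 < q ^ 2 := by positivity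
    have e3 : 63 / 100 * (D - q ^ 2 / 6) ^ 2 ≤
        q ^ 2 * (q ^ 2 / 2) + (D - 4 * q ^ 2 / 3) ^ 2 + q ^ 2 * D ^ 2 := by linarith
    generalize q ^ 2 = p at *
    obtain ⟨y, rfl⟩ : ∃ y, D = 4 * p / 3 + y := ⟨D - 4 * p / 3, by ring⟩
    have hy : 0 < y := by linarith
    have f1 : 0 ≤ p * p * (9 / 49 - p) := mul_nonneg (by positivity) (by linarith)
    have f2 : 0 ≤ y * p * (9 / 49 - p) := mul_nonneg (by positivity) (by linarith)
    have f3 : 0 ≤ y * (35 / 100 * p - y) := mul_nonneg hy.le (by linarith)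
    have f4 : 0 ≤ y * y * (9 / 49 - p) := mul_nonneg (by positivity) (by linarith)
    have f5 : 0 < p * p := by positivity
    have f6 : 0 < y * p := by positivity
    nlinarith

/-! ### Exponential tail bounds for sums of independent bounded variables -/

section Concentration

variable {Ω κ : Type*} [MeasurableSpace Ω] {μ : Measure Ω} [IsProbabilityMeasure μ]

lemma integrable_of_ae_abs_le {Z : Type*} [MeasurableSpace Z] {ν : Measure Z} [IsFiniteMeasure ν]
    {X : Z → ℝ} (hm : AEStronglyMeasurable X ν) {K : ℝ}
    (hb : ∀ᵐ ω ∂ν, |X ω| ≤ K) : Integrable X ν :=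
  Integrable.of_bound hm K (by simpa only [Real.norm_eq_abs] using hb)

lemma integrable_exp_mul_of_ae_abs_le {X : Ω → ℝ} (hm : Measurable X) {K : ℝ}
    (hb : ∀ᵐ ω ∂μ, |X ω| ≤ K) (l : ℝ) : Integrable (fun ω => Real.exp (l * X ω)) μ := by
  refine integrable_of_ae_abs_le (K := Real.exp (|l| * K))
    (by fun_prop : Measurable _).aestronglyMeasurable ?_
  filter_upwards [hb] with ω h
  rw [Real.abs_exp, Real.exp_le_exp]
  calc l * X ω ≤ |l * X ω| := le_abs_self _
    _ = |l| * |X ω| := abs_mul _ _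
    _ ≤ |l| * K := by gcongr

lemma mgf_le_exp_mul_of_centered {X : Ω → ℝ} (hm : Measurable X) (hb : ∀ᵐ ω ∂μ, |X ω| ≤ 1)
    (h0 : ∫ ω, X ω ∂μ = 0) {l : ℝ} (hl : 0 ≤ l) :
    mgf X μ l ≤ Real.exp ((∫ ω, X ω ^ 2 ∂μ) * (Real.exp l - 1 - l)) := by
  have hX := integrable_of_ae_abs_le hm.aestronglyMeasurable hb
  have hX2 : Integrable (fun ω => X ω ^ 2) μ := by
    refine integrable_of_ae_abs_le (K := 1) (by fun_prop : Measurable _).aestronglyMeasurable ?_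
    filter_upwards [hb] with ω h
    rw [abs_pow]
    exact pow_le_one₀ (abs_nonneg _) h
  calc mgf X μ l ≤ ∫ ω, (1 + l * X ω + X ω ^ 2 * (Real.exp l - 1 - l)) ∂μ := by
        refine integral_mono_ae (integrable_exp_mul_of_ae_abs_le hm hb l)
          (((integrable_const _).add (hX.const_mul _)).add (hX2.mul_const _)) ?_
        filter_upwards [hb] with ω h
        exact exp_mul_le_one_add_mul_add_sq_mul hl h
    _ = 1 + (∫ ω, X ω ^ 2 ∂μ) * (Real.exp l - 1 - l) := by
        have hA : Integrable (fun ω => 1 + l * X ω) μ := (integrable_const _).add (hX.const_mul _)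
        rw [integral_add hA (hX2.mul_const _),
          integral_add (integrable_const _) (hX.const_mul _), integral_const_mul,
          integral_mul_const, h0]
        simp
    _ ≤ _ := by rw [add_comm]; exact Real.add_one_le_exp _

lemma mgf_le_exp_mul_of_mem_Icc {X : Ω → ℝ} (hm : Measurable X)
    (hb : ∀ᵐ ω ∂μ, X ω ∈ Set.Icc (0 : ℝ) 1) (l : ℝ) :
    mgf X μ l ≤ Real.exp ((∫ ω, X ω ∂μ) * (Real.exp l - 1)) := by
  have hb' : ∀ᵐ ω ∂μ, |X ω| ≤ 1 := by
    filter_upwards [hb] with ω h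
    rw [abs_of_nonneg h.1]
    exact h.2
  have hX := integrable_of_ae_abs_le hm.aestronglyMeasurable hb'
  calc mgf X μ l ≤ ∫ ω, (1 + X ω * (Real.exp l - 1)) ∂μ := by
        refine integral_mono_ae (integrable_exp_mul_of_ae_abs_le hm hb' l)
          ((integrable_const _).add (hX.mul_const _)) ?_
        filter_upwards [hb] with ω h
        exact exp_mul_le_one_add_mul_exp_sub_one l h.1 h.2
    _ = 1 + (∫ ω, X ω ∂μ) * (Real.exp l - 1) := by
        rw [integral_add (integrable_const _) (hX.mul_const _), integral_mul_const]
        simp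
    _ ≤ _ := by rw [add_comm]; exact Real.add_one_le_exp _

variable [Fintype κ]

lemma measureReal_le_sum_le_exp {X : κ → Ω → ℝ} (hm : ∀ i, Measurable (X i))
    (hind : iIndepFun X μ) {K : ℝ} (hb : ∀ i, ∀ᵐ ω ∂μ, |X i ω| ≤ K) {l : ℝ} (hl : 0 ≤ l)
    {c : κ → ℝ} (hc : ∀ i, mgf (X i) μ l ≤ Real.exp (c i)) (ε : ℝ) :
    μ.real {ω | ε ≤ ∑ i, X i ω} ≤ Real.exp (-l * ε + ∑ i, c i) := by
  have hb' : ∀ᵐ ω ∂μ, |(∑ i, X i) ω| ≤ ∑ _i : κ, K := by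
    filter_upwards [ae_all_iff.2 hb] with ω h
    rw [Finset.sum_apply]
    exact (Finset.abs_sum_le_sum_abs _ _).trans (Finset.sum_le_sum fun i _ => h i)
  have h := measure_ge_le_exp_mul_mgf ε hl
    (integrable_exp_mul_of_ae_abs_le (X := ∑ i, X i) (by
      simpa only [Finset.sum_fn] using Finset.univ.measurable_sum fun i _ => hm i) hb' l)
  rw [hind.mgf_sum hm] at h
  simp only [Finset.sum_apply] at h
  refine h.trans ?_
  rw [Real.exp_add, Real.exp_sum]
  gcongr with i
  · exact fun i _ => mgf_nonneg
  · exact hc i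

/-- Bernstein's inequality, in its sharp two-term form. -/
lemma bernstein {X : κ → Ω → ℝ} (hm : ∀ i, Measurable (X i)) (hind : iIndepFun X μ)
    (hb : ∀ i, ∀ᵐ ω ∂μ, |X i ω| ≤ 1) (h0 : ∀ i, ∫ ω, X i ω ∂μ = 0) {n v a : ℝ} (hn : 0 ≤ n)
    (hv0 : 0 ≤ v) (hv : ∑ i, ∫ ω, X i ω ^ 2 ∂μ ≤ n * v) (ha : 0 < a) :
    μ.real {ω | n * (√(2 * a) * √v + a / 3) ≤ ∑ i, X i ω} ≤ Real.exp (-(n * a)) := by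
  set q := √(2 * a) with hq
  set s := √v with hs
  have hqa : q ^ 2 = 2 * a := Real.sq_sqrt (by positivity)
  have hsv : s ^ 2 = v := Real.sq_sqrt hv0
  have hq0 : 0 < q := Real.sqrt_pos.2 (by positivity)
  have hs0 : 0 ≤ s := Real.sqrt_nonneg _
  -- With this exponent `1 - l/3 = s/(s + q/3)`, and the Chernoff exponent comes out as exactly `-n
  -- a`.
  set l := q / (s + q / 3) with hl
  have hd : 0 < s + q / 3 := by positivity
  have hl0 : 0 ≤ l := by positivity
  refine (measureReal_le_sum_le_exp hm hind hb hl0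
    (fun i => mgf_le_exp_mul_of_centered (hm i) (hb i) (h0 i) hl0) _).trans ?_
  rw [Real.exp_le_exp, ← Finset.sum_mul]
  have hg0 : 0 ≤ Real.exp l - 1 - l := by linarith [Real.add_one_le_exp l]
  have key : v * (Real.exp l - 1 - l) ≤ s * q ^ 2 / (2 * (s + q / 3)) := by
    -- If `s = 0` then `l = 3`, outside the range of the geometric bound, but the factor `v`
    -- vanishes.
    rcases hs0.eq_or_lt with h | h
    · rw [← hsv, ← h]
      simp
    · have hl3 : l < 3 := by
        rw [hl, div_lt_iff₀ hd]
        linarith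
      have h1 : 1 - l / 3 = s / (s + q / 3) := by
        rw [hl]
        field_simp
        ring
      calc v * (Real.exp l - 1 - l) ≤ v * (l ^ 2 / (2 * (1 - l / 3))) := by
            gcongr
            exact exp_sub_one_sub_id_le hl0 hl3
        _ = _ := by
            rw [h1, ← hsv, hl]
            field_simp
  have key2 : l * (q * s + a / 3) = s * q ^ 2 / (2 * (s + q / 3)) + a := by
    have ha' : a = q ^ 2 / 2 := by linarith
    rw [hl, ha']
    field_simp
    ring
  calc -l * (n * (q * s + a / 3)) + (∑ i, ∫ ω, X i ω ^ 2 ∂μ) * (Real.exp l - 1 - l)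
      ≤ -l * (n * (q * s + a / 3)) + n * v * (Real.exp l - 1 - l) := by gcongr
    _ = n * (v * (Real.exp l - 1 - l)) - n * (l * (q * s + a / 3)) := by ring
    _ ≤ n * (s * q ^ 2 / (2 * (s + q / 3))) - n * (l * (q * s + a / 3)) := by gcongr
    _ = _ := by rw [key2]; ring

lemma measureReal_sum_le_le_exp {X : κ → Ω → ℝ} (hm : ∀ i, Measurable (X i))
    (hind : iIndepFun X μ) (hb : ∀ i, ∀ᵐ ω ∂μ, X i ω ∈ Set.Icc (0 : ℝ) 1) {l : ℝ} (hl : 0 ≤ l)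
    (ε : ℝ) :
    μ.real {ω | ∑ i, X i ω ≤ ε} ≤
      Real.exp (l * ε - (∑ i, ∫ ω, X i ω ∂μ) * (1 - Real.exp (-l))) := by
  have h := measureReal_le_sum_le_exp (X := fun i ω => -X i ω) (μ := μ) (K := 1)
    (fun i => (hm i).neg) (hind.comp (fun _ x => -x) fun _ => measurable_neg)
    (fun i => by
      filter_upwards [hb i] with ω h
      rw [abs_neg, abs_of_nonneg h.1]
      exact h.2) hl
    (c := fun i => (∫ ω, X i ω ∂μ) * (Real.exp (-l) - 1)) (fun i => by
      have := mgf_le_exp_mul_of_mem_Icc (hm i) (hb i) (-l)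
      rwa [← mgf_neg] at this) (-ε)
  simp only [Finset.sum_neg_distrib, neg_le_neg_iff] at h
  refine h.trans_eq ?_
  rw [← Finset.sum_mul]
  congr 1
  ring

/-- For values in `[0,1]` the second moment is at most the mean, so the lower tail is sub-Gaussian
with no linear correction term; `l = q / s` is the optimal exponent. -/
lemma lower_tail_gaussian {X : κ → Ω → ℝ} (hm : ∀ i, Measurable (X i))
    (hind : iIndepFun X μ) (hb : ∀ i, ∀ᵐ ω ∂μ, X i ω ∈ Set.Icc (0 : ℝ) 1) {n v a : ℝ}
    (hn : 0 < n) (hv0 : 0 < v) (hv : n * v = ∑ i, ∫ ω, X i ω ∂μ) (ha : 0 < a) :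
    μ.real {ω | ∑ i, X i ω ≤ n * (v - √(2 * a) * √v)} ≤ Real.exp (-(n * a)) := by
  set q := √(2 * a) with hq
  set s := √v with hs
  have hqa : q ^ 2 = 2 * a := Real.sq_sqrt (by positivity)
  have hsv : s ^ 2 = v := Real.sq_sqrt hv0.le
  have hs0 : 0 < s := Real.sqrt_pos.2 hv0
  set l := q / s with hl
  have hl0 : 0 ≤ l := by positivity
  refine (measureReal_sum_le_le_exp hm hind hb hl0 _).trans ?_
  rw [Real.exp_le_exp, ← hv]
  have h1 := exp_neg_le_one_sub_add_sq_div_two hl0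
  calc l * (n * (v - q * s)) - n * v * (1 - Real.exp (-l))
      ≤ l * (n * (v - q * s)) - n * v * (1 - (1 - l + l ^ 2 / 2)) := by gcongr
    _ = _ := by
      have ha' : a = q ^ 2 / 2 := by linarith
      rw [hl, ha', ← hsv]
      field_simp
      ring

/-- Chernoff with exponent `1`; `63/100` is a lower bound for `1 - 1/e`. -/
lemma lower_tail_poisson {X : κ → Ω → ℝ} (hm : ∀ i, Measurable (X i))
    (hind : iIndepFun X μ) (hb : ∀ i, ∀ᵐ ω ∂μ, X i ω ∈ Set.Icc (0 : ℝ) 1) {n v a : ℝ}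
    (hn : 0 ≤ n) (hv0 : 0 ≤ v) (hv : n * v = ∑ i, ∫ ω, X i ω ∂μ) :
    μ.real {ω | ∑ i, X i ω ≤ n * (63 / 100 * v - a)} ≤ Real.exp (-(n * a)) := by
  refine (measureReal_sum_le_le_exp hm hind hb zero_le_one _).trans ?_
  rw [Real.exp_le_exp, ← hv]
  have h1 := Real.exp_neg_one_lt_d9
  have h2 : n * v * (63 / 100) ≤ n * v * (1 - Real.exp (-1)) := by
    gcongr
    norm_num at h1 ⊢
    linarith
  linarith

lemma upper_tail_poisson {X : κ → Ω → ℝ} (hm : ∀ i, Measurable (X i))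
    (hind : iIndepFun X μ) (hb : ∀ i, ∀ᵐ ω ∂μ, X i ω ∈ Set.Icc (0 : ℝ) 1) {n v a : ℝ}
    (hn : 0 ≤ n) (hv0 : 0 ≤ v) (hv : n * v = ∑ i, ∫ ω, X i ω ∂μ) :
    μ.real {ω | n * (2 * v + a) ≤ ∑ i, X i ω} ≤ Real.exp (-(n * a)) := by
  refine (measureReal_le_sum_le_exp hm hind (K := 1) (fun i => ?_) zero_le_one
    (fun i => mgf_le_exp_mul_of_mem_Icc (hm i) (hb i) 1) _).trans ?_
  · filter_upwards [hb i] with ω h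
    rw [abs_of_nonneg h.1]
    exact h.2
  · rw [Real.exp_le_exp, ← Finset.sum_mul, ← hv]
    have h1 := Real.exp_one_lt_d9
    have h2 : n * v * (Real.exp 1 - 1) ≤ n * v * 2 := by
      gcongr
      norm_num at h1
      linarith
    linarith

/-- The empirical Bernstein inequality for independent variables in an interval of length one,
which need not be identically distributed, with an upper bound for the sample variance. -/
theorem empirical_bernstein_unit [Nonempty κ] {Y : κ → Ω → ℝ} (hm : ∀ i, Measurable (Y i))
    (hind : iIndepFun Y μ) {lo : ℝ} (hY : ∀ i, ∀ᵐ ω ∂μ, Y i ω ∈ Set.Icc lo (lo + 1))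
    {n m v a : ℝ} (hn : n = Fintype.card κ) (hmm : n * m = ∑ i, ∫ ω, Y i ω ∂μ)
    (hv : n * v = ∑ i, ∫ ω, (Y i ω - m) ^ 2 ∂μ) (ha : 0 < a) :
    μ.real {ω | ¬ ∀ M V, n * M = ∑ i, Y i ω → n * V = ∑ i, (Y i ω - M) ^ 2 →
      |M - m| ≤ 1 ∧ |M - m| ≤ √(2 * a) * √V + 8 * a / 3 ∧ V ≤ 2 * v + a} ≤
      4 * Real.exp (-(n * a)) := by
  have hn0 : 0 < n := by rw [hn]; exact_mod_cast Fintype.card_pos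
  have hint : ∀ i, Integrable (Y i) μ := fun i =>
    integrable_of_ae_abs_le (K := |lo| + 1) (hm i).aestronglyMeasurable (by
      filter_upwards [hY i] with ω h
      rw [abs_le]
      constructor <;> linarith [h.1, h.2, neg_abs_le lo, le_abs_self lo])
  have hE : ∀ i, ∫ ω, Y i ω ∂μ ∈ Set.Icc lo (lo + 1) := fun i => by
    constructor
    · have := integral_mono_ae (integrable_const lo) (hint i)
        (by filter_upwards [hY i] with ω h using h.1)
      simpa using this
    · have := integral_mono_ae (hint i) (integrable_const (lo + 1))
        (by filter_upwards [hY i] with ω h using h.2)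
      simpa using this
  have havg : ∀ (y : κ → ℝ) (M : ℝ), (∀ i, y i ∈ Set.Icc lo (lo + 1)) → n * M = ∑ i, y i →
      M ∈ Set.Icc lo (lo + 1) := fun y M hy hM => by
    have h1 : ∑ _i : κ, lo ≤ ∑ i, y i := Finset.sum_le_sum fun i _ => (hy i).1
    have h2 : ∑ i, y i ≤ ∑ _i : κ, (lo + 1) := Finset.sum_le_sum fun i _ => (hy i).2
    rw [Finset.sum_const, Finset.card_univ, nsmul_eq_mul, ← hn, ← hM] at h1 h2
    exact ⟨le_of_mul_le_mul_left h1 hn0, le_of_mul_le_mul_left h2 hn0⟩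
  have hmI := havg _ m hE hmm
  have hsqb : ∀ i, ∀ᵐ ω ∂μ, (Y i ω - m) ^ 2 ∈ Set.Icc (0 : ℝ) 1 := fun i => by
    filter_upwards [hY i] with ω h
    refine ⟨sq_nonneg _, ?_⟩
    rw [sq_le_one_iff_abs_le_one, abs_le]
    constructor <;> linarith [h.1, h.2, hmI.1, hmI.2]
  have hsqm : ∀ i, Measurable fun ω => (Y i ω - m) ^ 2 := fun i => by
    have := hm i
    fun_prop
  have hsqi : ∀ i, Integrable (fun ω => (Y i ω - m) ^ 2) μ := fun i =>
    integrable_of_ae_abs_le (K := 1) (hsqm i).aestronglyMeasurable (by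
      filter_upwards [hsqb i] with ω h
      rw [abs_of_nonneg h.1]
      exact h.2)
  have hsqind : iIndepFun (fun i ω => (Y i ω - m) ^ 2) μ :=
    hind.comp (fun _ x => (x - m) ^ 2) fun _ => by fun_prop
  have hv0 : 0 ≤ v := by
    have : 0 ≤ n * v := by
      rw [hv]
      exact Finset.sum_nonneg fun i _ => integral_nonneg fun ω => sq_nonneg _
    exact nonneg_of_mul_nonneg_right this hn0
  -- Averaging `(Y - lo)(lo + 1 - Y) ≥ 0` gives `v ≤ (m - lo)(lo + 1 - m)`, also for unequal means.
  have hv4 : v ≤ 1 / 4 := by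
    have h1 : ∀ i, ∫ ω, (Y i ω - m) ^ 2 ∂μ ≤
        (∫ ω, Y i ω ∂μ) * (2 * (lo - m) + 1) - lo * (lo + 1) + m ^ 2 := fun i => by
      have e : (∫ ω, Y i ω ∂μ) * (2 * (lo - m) + 1) - lo * (lo + 1) + m ^ 2 =
          ∫ ω, (Y i ω * (2 * (lo - m) + 1) + (m ^ 2 - lo * (lo + 1))) ∂μ := by
        rw [integral_add ((hint i).mul_const _) (integrable_const _), integral_mul_const]
        simp
        ring
      rw [e]
      refine integral_mono_ae (hsqi i) (((hint i).mul_const _).add (integrable_const _)) ?_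
      filter_upwards [hY i] with ω h
      nlinarith [mul_nonneg (sub_nonneg.2 h.1) (sub_nonneg.2 h.2)]
    have h2 : n * v ≤ n * m * (2 * (lo - m) + 1) + n * (m ^ 2 - lo * (lo + 1)) := by
      rw [hv, hmm]
      refine (Finset.sum_le_sum fun i _ => h1 i).trans_eq ?_
      rw [Finset.sum_add_distrib, Finset.sum_sub_distrib, ← Finset.sum_mul, Finset.sum_const,
        Finset.sum_const, Finset.card_univ, nsmul_eq_mul, nsmul_eq_mul, ← hn]
      ring
    have h3 : v ≤ m * (2 * (lo - m) + 1) + (m ^ 2 - lo * (lo + 1)) := by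
      refine le_of_mul_le_mul_left (h2.trans_eq ?_) hn0
      ring
    nlinarith [sq_nonneg (m - lo - 1 / 2)]
  -- the variables centred at their own means
  have hcint : ∀ i, ∫ ω, (Y i ω - ∫ ω', Y i ω' ∂μ) ∂μ = 0 := fun i => by
    rw [integral_sub (hint i) (integrable_const _)]
    simp
  have hcb : ∀ i, ∀ᵐ ω ∂μ, |Y i ω - ∫ ω', Y i ω' ∂μ| ≤ 1 := fun i => by
    filter_upwards [hY i] with ω h
    rw [abs_le]
    constructor <;> linarith [h.1, h.2, (hE i).1, (hE i).2]
  have hcm : ∀ i, Measurable fun ω => Y i ω - ∫ ω', Y i ω' ∂μ := fun i => (hm i).sub_const _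
  have hcind : iIndepFun (fun i ω => Y i ω - ∫ ω', Y i ω' ∂μ) μ :=
    hind.comp (fun i x => x - ∫ ω', Y i ω' ∂μ) fun _ => by fun_prop
  -- Each mean minimizes its own quadratic deviation, so recentring from the common `m` only lowers
  -- the sum.
  have hcv : ∑ i, ∫ ω, (Y i ω - ∫ ω', Y i ω' ∂μ) ^ 2 ∂μ ≤ n * v := by
    rw [hv]
    refine Finset.sum_le_sum fun i _ => ?_
    have e : ∀ ω, (Y i ω - ∫ ω', Y i ω' ∂μ) ^ 2 = (Y i ω - m) ^ 2 +
        (2 * (m - ∫ ω', Y i ω' ∂μ) * (Y i ω - ∫ ω', Y i ω' ∂μ) - (m - ∫ ω', Y i ω' ∂μ) ^ 2) :=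
      fun ω => by ring
    have hci : Integrable (fun ω => Y i ω - ∫ ω', Y i ω' ∂μ) μ := (hint i).sub (integrable_const _)
    have hA : Integrable (fun ω => 2 * (m - ∫ ω', Y i ω' ∂μ) * (Y i ω - ∫ ω', Y i ω' ∂μ) -
        (m - ∫ ω', Y i ω' ∂μ) ^ 2) μ := (hci.const_mul _).sub (integrable_const _)
    simp_rw [e]
    rw [integral_add (hsqi i) hA,
      integral_sub (hci.const_mul _) (integrable_const _), integral_const_mul, hcint i]
    simp
    positivity
  have b1 := bernstein hcm hcind hcb hcint hn0.le hv0 hcv ha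
  have b2 := bernstein (X := fun i ω => -(Y i ω - ∫ ω', Y i ω' ∂μ)) (fun i => (hcm i).neg)
    (hcind.comp (fun _ x => -x) fun _ => measurable_neg) (fun i => by simpa only [abs_neg] using hcb i)
    (fun i => by rw [integral_neg, hcint i, neg_zero]) hn0.le hv0 (by simpa only [neg_sq] using hcv) ha
  have b4 := upper_tail_poisson (a := a) hsqm hsqind hsqb hn0.le hv0 hv
  have b5 : μ.real {ω | ¬ ∀ i, Y i ω ∈ Set.Icc lo (lo + 1)} = 0 := by
    rw [measureReal_eq_zero_iff]
    exact ae_all_iff.2 hY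
  -- Which lower tail is needed depends only on the deterministic `a`, so one exceptional set pays
  -- for both. With two Bernstein tails and one upper variance tail this makes the factor `4`.
  obtain ⟨T, hT, hlow, hmid⟩ : ∃ T : Set Ω, μ.real T ≤ Real.exp (-(n * a)) ∧
      (∀ ω ∉ T, √(2 * a) ^ 2 < 7 / 64 →
        n * (√v ^ 2 - √(2 * a) * √v) ≤ ∑ i, (Y i ω - m) ^ 2) ∧
      ∀ ω ∉ T, 7 / 64 ≤ √(2 * a) ^ 2 →
        n * (63 / 100 * √v ^ 2 - √(2 * a) ^ 2 / 2) ≤ ∑ i, (Y i ω - m) ^ 2 := by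
    rw [Real.sq_sqrt hv0, Real.sq_sqrt (by positivity)]
    by_cases h7 : 2 * a < 7 / 64
    · rcases hv0.eq_or_lt with h | h
      · refine ⟨∅, by simp; positivity, fun ω _ _ => ?_, fun _ _ h => absurd h (not_le.2 h7)⟩
        rw [← h]
        simp
        positivity
      · exact ⟨_, lower_tail_gaussian hsqm hsqind hsqb hn0 h hv ha,
          fun ω hω _ => (not_le.1 hω).le, fun _ _ h => absurd h (not_le.2 h7)⟩
    · refine ⟨_, lower_tail_poisson (a := a) hsqm hsqind hsqb hn0.le hv0 hv,
          fun ω _ h => absurd h h7, fun ω hω _ => ?_⟩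
      rw [show 2 * a / 2 = a by ring]
      exact (not_le.1 hω).le
  set S1 := {ω | n * (√(2 * a) * √v + a / 3) ≤ ∑ i, (Y i ω - ∫ ω', Y i ω' ∂μ)}
  set S2 := {ω | n * (√(2 * a) * √v + a / 3) ≤ ∑ i, -(Y i ω - ∫ ω', Y i ω' ∂μ)}
  set S4 := {ω | n * (2 * v + a) ≤ ∑ i, (Y i ω - m) ^ 2}
  set S5 := {ω | ¬ ∀ i, Y i ω ∈ Set.Icc lo (lo + 1)}
  have hsub : {ω | ¬ ∀ M V, n * M = ∑ i, Y i ω → n * V = ∑ i, (Y i ω - M) ^ 2 →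
      |M - m| ≤ 1 ∧ |M - m| ≤ √(2 * a) * √V + 8 * a / 3 ∧ V ≤ 2 * v + a} ⊆
      S1 ∪ S2 ∪ S4 ∪ S5 ∪ T := by
    intro ω hω
    by_contra hc
    simp only [Set.mem_union, not_or] at hc
    obtain ⟨⟨⟨⟨h1, h2⟩, h4⟩, h5⟩, hT⟩ := hc
    simp only [S1, S2, S4, S5, Set.mem_ofPred_eq, not_le, not_not] at h1 h2 h4 h5
    refine hω fun M V hM hV => ?_
    have hMI := havg _ M h5 hM
    have hsum : ∑ i, (Y i ω - ∫ ω', Y i ω' ∂μ) = n * (M - m) := by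
      rw [Finset.sum_sub_distrib, ← hM, ← hmm]
      ring
    rw [hsum] at h1
    rw [Finset.sum_neg_distrib, hsum, ← mul_neg] at h2
    have h1 := lt_of_mul_lt_mul_left h1 hn0.le
    have h2 := lt_of_mul_lt_mul_left h2 hn0.le
    have hS : ∑ i, (Y i ω - m) ^ 2 = n * (V + (M - m) ^ 2) := by
      have e : ∀ i, (Y i ω - m) ^ 2 =
          (Y i ω - M) ^ 2 + (2 * (M - m) * Y i ω - (M ^ 2 - m ^ 2)) := fun i => by ring
      simp_rw [e]
      rw [Finset.sum_add_distrib, Finset.sum_sub_distrib, ← Finset.mul_sum, ← hM, ← hV,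
        Finset.sum_const, Finset.card_univ, nsmul_eq_mul, ← hn]
      ring
    have hV0 : 0 ≤ V := by
      have : 0 ≤ n * V := by
        rw [hV]
        exact Finset.sum_nonneg fun i _ => sq_nonneg _
      exact nonneg_of_mul_nonneg_right this hn0
    rw [hS] at h4
    have h4 := lt_of_mul_lt_mul_left h4 hn0.le
    have hq2 : √(2 * a) ^ 2 = 2 * a := Real.sq_sqrt (by positivity)
    refine ⟨?_, ?_, by nlinarith [sq_nonneg (M - m)]⟩
    · rw [abs_le]
      constructor <;> linarith [hMI.1, hMI.2, hmI.1, hmI.2]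
    · have := empirical_bernstein_core (q := √(2 * a)) (s := √v) (w := √V) (D := |M - m|)
        (Real.sqrt_pos.2 (by positivity))
        (by rw [Real.sqrt_le_left (by norm_num)]; linarith) (Real.sqrt_nonneg _)
        (by rw [hq2]; exact abs_le.2 ⟨by linarith, by linarith⟩)
        (fun h => by
          have := hlow ω hT h
          rw [hS] at this
          rw [Real.sq_sqrt hV0, sq_abs]
          exact le_of_mul_le_mul_left this hn0)
        (fun h => by
          have := hmid ω hT h
          rw [hS] at this
          rw [Real.sq_sqrt hV0, sq_abs]
          exact le_of_mul_le_mul_left this hn0)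
      rw [hq2] at this
      linarith
  refine (measureReal_mono hsub).trans ?_
  have u1 := measureReal_union_le (μ := μ) (S1 ∪ S2 ∪ S4 ∪ S5) T
  have u2 := measureReal_union_le (μ := μ) (S1 ∪ S2 ∪ S4) S5
  have u3 := measureReal_union_le (μ := μ) (S1 ∪ S2) S4
  have u4 := measureReal_union_le (μ := μ) S1 S2
  linarith

end Concentration

/-! ### The adaptive window -/

/-- Oracle inequality for the adaptive window, on the event where every `psiHat` bounds the
deviation of the window mean from its expectation. -/
lemma abs_windowMean_sub_le {B : ℕ → ℕ} {u : ℕ → ℕ → ℝ} {M δ : ℝ} {t k khat : ℕ}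
    (hkhat : IsAdaptiveWindow B u M δ t khat) (hk : k ∈ Set.Icc 1 t) {m : ℕ → ℝ}
    (hm : ∀ i ∈ Set.Icc 1 t, |windowMean B u t i - m i| ≤ psiHat B u M δ t i) {θ b : ℝ}
    (hb : ∀ i ∈ Set.Icc 1 k, |m i - θ| ≤ b) :
    |windowMean B u t khat - θ| ≤ 5 * b + 3 * psiHat B u M δ t k := by
  obtain ⟨hkt, hmin⟩ := hkhat
  have hkk : k ∈ Set.Icc 1 k := ⟨hk.1, le_rfl⟩
  have hb0 : 0 ≤ b := (abs_nonneg _).trans (hb k hkk)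
  have hψ : ∀ i ∈ Set.Icc 1 t, 0 ≤ psiHat B u M δ t i := fun i hi =>
    (abs_nonneg _).trans (hm i hi)
  -- Both `m k` and `m i` lie within `b` of `θ`; the stochastic parts are absorbed by the subtracted
  -- `psiHat` terms.
  have hφ : phiHat B u M δ t k ≤ 2 * b := by
    have : Nonempty (Set.Icc 1 k) := ⟨⟨k, hkk⟩⟩
    refine ciSup_le fun i => max_le ?_ (by positivity)
    have h1 := abs_le.1 (hm k hk)
    have h2 := abs_le.1 (hm i ⟨i.2.1, i.2.2.trans hk.2⟩)
    have h3 := abs_le.1 (hb k hkk)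
    have h4 := abs_le.1 (hb i i.2)
    have : |windowMean B u t k - windowMean B u t i| ≤
        2 * b + (psiHat B u M δ t k + psiHat B u M δ t i) :=
      abs_le.2 ⟨by linarith, by linarith⟩
    linarith
  have hle : ∀ r : ℕ, ∀ i ∈ Set.Icc 1 r, |windowMean B u t r - windowMean B u t i| ≤
      phiHat B u M δ t r + (psiHat B u M δ t r + psiHat B u M δ t i) := fun r i hi => by
    have h := le_ciSup (f := fun i : Set.Icc 1 r => max (|windowMean B u t r - windowMean B u t i|
      - (psiHat B u M δ t r + psiHat B u M δ t i)) 0) (Set.finite_range _).bddAbove ⟨i, hi⟩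
    have h2 := (le_max_left _ _).trans h
    rw [sub_le_iff_le_add] at h2
    exact h2
  have hφ0 : ∀ r : ℕ, 0 ≤ phiHat B u M δ t r := fun r =>
    Real.iSup_nonneg fun i => le_max_right _ _
  have hopt := hmin k hk
  have h0 := hφ0 khat
  have hψ1 := hψ khat hkt
  -- The longer of the two windows has the shorter one in its `phiHat`. Minimality bounds `phiHat +
  -- psiHat` at `khat` by `2b + psiHat` at `k`; the second case also spends `phiHat` at `k`, hence
  -- `4b`.
  have hd : |windowMean B u t khat - windowMean B u t k| ≤ 4 * b + 2 * psiHat B u M δ t k := by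
    rcases le_total k khat with h | h
    · have := hle khat k ⟨hk.1, h⟩
      linarith
    · have := hle k khat ⟨hkt.1, h⟩
      rw [abs_sub_comm] at this
      linarith
  have e1 := abs_le.1 hd
  have e2 := abs_le.1 (hm k hk)
  have e3 := abs_le.1 (hb k hkk)
  exact abs_le.2 ⟨by linarith, by linarith⟩

lemma windowSize_pos {B : ℕ → ℕ} (hB : ∀ j, 1 ≤ j → 1 ≤ B j) {t k : ℕ} (hk : k ∈ Set.Icc 1 t) :
    1 ≤ windowSize B t k := by
  have ht : t ∈ Finset.Icc (t - k + 1) t := Finset.mem_Icc.2 ⟨by have := hk.1; have := hk.2; omega, le_rfl⟩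
  exact (hB t (hk.1.trans hk.2)).trans (Finset.single_le_sum (fun _ _ => Nat.zero_le _) ht)

/-- Bounds on `psiHat` in terms of a population version `V` of the (rescaled) window variance. -/
lemma le_psiHat_le {B : ℕ → ℕ} {u : ℕ → ℕ → ℝ} {M δ : ℝ} {t k : ℕ}
    (hn : 1 ≤ windowSize B t k) (hM : 0 ≤ M) (hL : 1 ≤ Real.log (2 / δ)) {D V v W a : ℝ}
    (ha : a = Real.log (2 / δ) / (windowSize B t k : ℝ)) (hV0 : 0 ≤ V)
    (hV : ((windowSize B t k : ℝ) - 1) * windowVar B u t k = windowSize B t k * (M ^ 2 * V))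
    (hD1 : D ≤ 1) (hD : D ≤ √(2 * a) * √V + 8 * a / 3) (hVv : V ≤ 2 * v + a)
    (hvW : M ^ 2 * v ≤ W) :
    M * D ≤ psiHat B u M δ t k ∧ psiHat B u M δ t k ≤ 3 * (√a * √W) + 8 * (a * M) := by
  set n := windowSize B t k with hn'
  set l := Real.log (2 / δ)
  have hn1 : (1 : ℝ) ≤ n := by exact_mod_cast hn
  have ha0 : 0 < a := by rw [ha]; positivity
  unfold psiHat
  rw [← hn']
  split_ifs with h1
  -- A single sample: `D ≤ 1` gives the lower bound, and `a = log(2/δ) ≥ 1` lets `8aM` absorb `M`.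
  · rw [h1, Nat.cast_one, div_one] at ha
    refine ⟨by nlinarith, ?_⟩
    have : 0 ≤ √a * √W := by positivity
    nlinarith
  · have hn2 : (2 : ℝ) ≤ n := by exact_mod_cast (show 2 ≤ n by omega)
    have hl : l = a * n := by rw [ha]; field_simp
    have hVl : M ^ 2 * V ≤ windowVar B u t k := by
      by_contra! hc
      have e1 : 0 ≤ M ^ 2 * V := by positivity
      nlinarith
    -- The two variance normalizations differ by `n/(n - 1)`, which lies between `1` and `2`.
    have hVu : windowVar B u t k ≤ 2 * (M ^ 2 * V) := by
      by_contra! hc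
      have e1 : 0 ≤ M ^ 2 * V := by positivity
      nlinarith
    have hs1 : M * √V ≤ √(windowVar B u t k) := by
      refine Real.le_sqrt_of_sq_le ?_
      rwa [mul_pow, Real.sq_sqrt hV0]
    have e2 : 2 * l / n = 2 * a := by rw [ha]; ring
    have hl1 : a ≤ l / (n - 1) := by rw [ha]; gcongr <;> linarith
    have hl2 : l / (n - 1) ≤ 2 * a := by
      rw [hl, div_le_iff₀ (by linarith)]
      nlinarith
    have e3 : 8 * M * l / (3 * ((n : ℝ) - 1)) = 8 / 3 * M * (l / (n - 1)) := by
      field_simp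
    rw [e2, e3]
    constructor
    · calc M * D ≤ M * (√(2 * a) * √V + 8 * a / 3) := by gcongr
        _ = M * √V * √(2 * a) + 8 / 3 * M * a := by ring
        _ ≤ _ := by gcongr
    · have hW : 0 ≤ 4 * W + 2 * (M ^ 2 * a) := by
        have : 0 ≤ M ^ 2 * V := by positivity
        nlinarith [mul_le_mul_of_nonneg_left hVv (sq_nonneg M)]
      have e4 : windowVar B u t k ≤ 4 * W + 2 * (M ^ 2 * a) := by
        nlinarith [mul_le_mul_of_nonneg_left hVv (sq_nonneg M)]
      have e5 : √(windowVar B u t k) * √(2 * a) ≤ 3 * (√a * √W) + 2 * (a * M) := by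
        rw [← Real.sqrt_mul' _ (by positivity)]
        by_cases hW0 : 0 ≤ W
        · refine Real.sqrt_le_left (by positivity) |>.2 ?_
          have s1 := Real.sq_sqrt hW0
          have s2 := Real.sq_sqrt ha0.le
          have s3 : 0 ≤ √a * √W * (a * M) := by positivity
          calc windowVar B u t k * (2 * a) ≤ (4 * W + 2 * (M ^ 2 * a)) * (2 * a) := by gcongr
            _ = 8 * (√a ^ 2 * √W ^ 2) + 4 * (a * M) ^ 2 := by rw [s1, s2]; ring
            _ ≤ _ := by nlinarith [sq_nonneg (√a * √W)]
        · push Not at hW0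
          refine Real.sqrt_le_left (by positivity) |>.2 ?_
          rw [Real.sqrt_eq_zero_of_nonpos hW0.le]
          nlinarith
      have e6 : 8 / 3 * M * (l / (n - 1)) ≤ 8 / 3 * M * (2 * a) := by gcongr
      have : 0 ≤ a * M := by positivity
      linarith

/-! ### Empirical Bernstein bounds for a rolling window. -/

section Concentration

variable {Ω : Type*} [MeasurableSpace Ω] {μ : Measure Ω} [IsProbabilityMeasure μ]

/-- Concentration of the window mean, with the empirical bound `psiHat` and a bound for `psiHat`
itself. -/
lemma measureReal_window_le {u : ℕ → ℕ → Ω → ℝ} {B : ℕ → ℕ} {t k : ℕ}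
    (hB : ∀ j, 1 ≤ j → 1 ≤ B j) (hk : k ∈ Set.Icc 1 t)
    (hmeas : ∀ j ∈ Set.Icc 1 t, ∀ i ∈ Set.Icc 1 (B j), Measurable (u j i))
    (hind : iIndepFun (fun p : {p : ℕ × ℕ // p.1 ∈ Set.Icc 1 t ∧ p.2 ∈ Set.Icc 1 (B p.1)} =>
      u p.1.1 p.1.2) μ) {lo M : ℝ} (hM : 0 < M)
    (hb : ∀ j ∈ Set.Icc 1 t, ∀ i ∈ Set.Icc 1 (B j), ∀ᵐ ω ∂μ, u j i ω ∈ Set.Icc lo (lo + M))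
    {e : ℕ → ℝ} (he : ∀ j ∈ Set.Icc 1 t, ∀ i ∈ Set.Icc 1 (B j), ∫ ω, u j i ω ∂μ = e j) {W : ℝ}
    (hW : ∀ j ∈ Set.Icc 1 t, ∀ i ∈ Set.Icc 1 (B j), ∫ ω, u j i ω ^ 2 ∂μ ≤ W)
    {δ : ℝ} (hL : 1 ≤ Real.log (2 / δ)) {m : ℝ}
    (hm : (windowSize B t k : ℝ) * m = ∑ j ∈ Finset.Icc (t - k + 1) t, (B j : ℝ) * e j) :
    μ.real {ω | ¬ (|windowMean B (fun j i => u j i ω) t k - m| ≤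
        psiHat B (fun j i => u j i ω) M δ t k ∧
      psiHat B (fun j i => u j i ω) M δ t k ≤
        3 * (√(Real.log (2 / δ) / windowSize B t k) * √W) +
          8 * (Real.log (2 / δ) / windowSize B t k * M))} ≤
      4 * Real.exp (-Real.log (2 / δ)) := by
  classical
  set s : Finset (Σ _ : ℕ, ℕ) :=
    (Finset.Icc (t - k + 1) t).sigma fun j => Finset.Icc 1 (B j) with hs
  have hmem : ∀ p : s, p.1.1 ∈ Set.Icc 1 t ∧ p.1.2 ∈ Set.Icc 1 (B p.1.1) := fun p => by
    have := Finset.mem_sigma.1 p.2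
    rw [Finset.mem_Icc, Finset.mem_Icc] at this
    exact ⟨⟨by omega, this.1.2⟩, this.2⟩
  have hsum : ∀ F : ℕ → ℕ → ℝ, ∑ p : s, F p.1.1 p.1.2 =
      ∑ j ∈ Finset.Icc (t - k + 1) t, ∑ i ∈ Finset.Icc 1 (B j), F j i := fun F => by
    rw [Finset.sum_coe_sort s (fun p => F p.1 p.2), hs, Finset.sum_sigma]
  have hcard : (windowSize B t k : ℝ) = Fintype.card s := by
    rw [Fintype.card_coe, hs, Finset.card_sigma, windowSize]
    simp
  have hn := windowSize_pos hB hk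
  have hne : Nonempty s := by
    rw [← Fintype.card_pos_iff]
    have : windowSize B t k = Fintype.card s := by exact_mod_cast hcard
    omega
  have hn1 : (1 : ℝ) ≤ windowSize B t k := by exact_mod_cast hn
  set n : ℝ := (windowSize B t k : ℝ) with hn'
  have hn0 : 0 < n := by linarith
  set a := Real.log (2 / δ) / n with ha
  have ha0 : 0 < a := by positivity
  have hna : n * a = Real.log (2 / δ) := by rw [ha]; field_simp
  set Y : s → Ω → ℝ := fun p ω => u p.1.1 p.1.2 ω / M with hY
  have hYm : ∀ p, Measurable (Y p) := fun p =>
    (hmeas _ (hmem p).1 _ (hmem p).2).div_const _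
  have hYind : iIndepFun Y μ := by
    have h1 := hind.precomp (g := fun p : s => ⟨(p.1.1, p.1.2), hmem p⟩) (by
      rintro ⟨⟨a, b⟩, h⟩ ⟨⟨c, d⟩, h'⟩ h''
      simp only [Subtype.mk.injEq, Prod.mk.injEq] at h''
      obtain ⟨rfl, rfl⟩ := h''
      rfl)
    exact h1.comp (fun _ x => x / M) fun _ => by fun_prop
  have hYb : ∀ p, ∀ᵐ ω ∂μ, Y p ω ∈ Set.Icc (lo / M) (lo / M + 1) := fun p => by
    filter_upwards [hb _ (hmem p).1 _ (hmem p).2] with ω h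
    refine ⟨by simp only [hY]; gcongr; exact h.1, ?_⟩
    rw [show lo / M + 1 = (lo + M) / M by field_simp]
    simp only [hY]
    gcongr
    exact h.2
  have hmm : n * (m / M) = ∑ p, ∫ ω, Y p ω ∂μ := by
    simp only [hY, integral_div]
    rw [← Finset.sum_div, hsum (fun j i => ∫ ω, u j i ω ∂μ), ← mul_div_assoc, hm]
    congr 1
    refine Finset.sum_congr rfl fun j hj => ?_
    rw [Finset.mem_Icc] at hj
    rw [Finset.sum_congr rfl fun i hi => he j ⟨by omega, hj.2⟩ i (Finset.mem_Icc.1 hi)]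
    simp
  set v := (∑ p, ∫ ω, (Y p ω - m / M) ^ 2 ∂μ) / n with hv
  have hv' : n * v = ∑ p, ∫ ω, (Y p ω - m / M) ^ 2 ∂μ := by
    rw [hv, mul_div_assoc', mul_div_cancel_left₀ _ hn0.ne']
  have hvW : M ^ 2 * v ≤ W := by
    have hYi : ∀ p, Integrable (Y p) μ := fun p =>
      integrable_of_ae_abs_le (K := |lo / M| + 1) (hYm p).aestronglyMeasurable (by
        filter_upwards [hYb p] with ω h
        rw [abs_le]
        constructor <;> linarith [h.1, h.2, neg_abs_le (lo / M), le_abs_self (lo / M)])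
    have hY2 : ∀ p, Integrable (fun ω => Y p ω ^ 2) μ := fun p =>
      integrable_of_ae_abs_le (K := (|lo / M| + 1) ^ 2)
        ((hYm p).pow_const 2).aestronglyMeasurable (by
        filter_upwards [hYb p] with ω h
        rw [abs_pow]
        refine pow_le_pow_left₀ (abs_nonneg _) (abs_le.2 ?_) 2
        constructor <;> linarith [h.1, h.2, neg_abs_le (lo / M), le_abs_self (lo / M)])
    have h1 : ∀ p, ∫ ω, (Y p ω - m / M) ^ 2 ∂μ =
        ∫ ω, Y p ω ^ 2 ∂μ - 2 * (m / M) * ∫ ω, Y p ω ∂μ + (m / M) ^ 2 := fun p => by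
      have hA : Integrable (fun ω => Y p ω ^ 2 - 2 * (m / M) * Y p ω) μ :=
        (hY2 p).sub ((hYi p).const_mul _)
      have e : ∀ ω, (Y p ω - m / M) ^ 2 = Y p ω ^ 2 - 2 * (m / M) * Y p ω + (m / M) ^ 2 :=
        fun ω => by ring
      simp_rw [e]
      rw [integral_add hA (integrable_const _), integral_sub (hY2 p) ((hYi p).const_mul _),
        integral_const_mul]
      simp
    have h2 : n * v = ∑ p, ∫ ω, Y p ω ^ 2 ∂μ - n * (m / M) ^ 2 := by
      rw [hv', Finset.sum_congr rfl fun p _ => h1 p, Finset.sum_add_distrib,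
        Finset.sum_sub_distrib, ← Finset.mul_sum, ← hmm, Finset.sum_const, Finset.card_univ,
        nsmul_eq_mul, ← hcard]
      ring
    have h3 : ∑ p, ∫ ω, Y p ω ^ 2 ∂μ ≤ n * (W / M ^ 2) := by
      refine (Finset.sum_le_sum (g := fun _ => W / M ^ 2) fun p _ => ?_).trans_eq ?_
      · simp only [hY, div_pow, integral_div]
        gcongr
        exact hW _ (hmem p).1 _ (hmem p).2
      · rw [Finset.sum_const, Finset.card_univ, nsmul_eq_mul, ← hcard]
    have h4 : n * v ≤ n * (W / M ^ 2) := by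
      have : 0 ≤ n * (m / M) ^ 2 := by positivity
      linarith
    have h5 := le_of_mul_le_mul_left h4 hn0
    rwa [le_div_iff₀ (by positivity), mul_comm] at h5
  have key := empirical_bernstein_unit hYm hYind hYb hcard hmm hv' ha0
  rw [hna] at key
  refine (measureReal_mono fun ω hω => ?_).trans key
  refine fun hgood => hω ?_
  set U : ℕ → ℕ → ℝ := fun j i => u j i ω with hU
  have hmean : n * (windowMean B U t k / M) = ∑ p, Y p ω := by
    simp only [hY]
    rw [← Finset.sum_div, hsum U, windowMean, ← hn']
    field_simp
  obtain ⟨g1, g2, g3⟩ := hgood _ ((∑ p, (Y p ω - windowMean B U t k / M) ^ 2) / n) hmean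
    (by rw [mul_div_assoc', mul_div_cancel_left₀ _ hn0.ne'])
  have hvar : (n - 1) * windowVar B U t k =
      n * (M ^ 2 * ((∑ p, (Y p ω - windowMean B U t k / M) ^ 2) / n)) := by
    have e1 : ∑ p, (Y p ω - windowMean B U t k / M) ^ 2 =
        (∑ j ∈ Finset.Icc (t - k + 1) t, ∑ i ∈ Finset.Icc 1 (B j),
          (U j i - windowMean B U t k) ^ 2) / M ^ 2 := by
      rw [← hsum (fun j i => (U j i - windowMean B U t k) ^ 2), Finset.sum_div]
      refine Finset.sum_congr rfl fun p _ => ?_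
      simp only [hY, hU]
      rw [← sub_div, div_pow]
    rw [e1, windowVar, ← hn']
    -- For `n = 1` the definition of `windowVar` divides by zero; the identity survives because the
    -- only sample equals the window mean.
    rcases eq_or_ne (n - 1) 0 with h | h
    · have h1 : Fintype.card s = 1 := by
        have : (Fintype.card s : ℝ) = 1 := by rw [← hcard]; linarith
        exact_mod_cast this
      have h2 := Finset.card_eq_one.1 (Finset.card_univ.trans h1)
      obtain ⟨p, hp⟩ := h2
      rw [h, zero_mul, ← hsum (fun j i => (U j i - windowMean B U t k) ^ 2), hp,
        Finset.sum_singleton]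
      rw [hp, Finset.sum_singleton, show n = 1 by linarith, one_mul] at hmean
      have : U p.1.1 p.1.2 = windowMean B U t k := by
        simp only [hY] at hmean
        field_simp at hmean
        exact hmean.symm
      rw [this]
      simp
    · field_simp
  have := le_psiHat_le (u := U) hn hM.le hL ha
    (div_nonneg (Finset.sum_nonneg fun p _ => sq_nonneg _) hn0.le) hvar g1 g2 g3 hvW
  refine ⟨?_, this.2⟩
  refine le_trans (le_of_eq ?_) this.1
  rw [← sub_div, abs_div, abs_of_pos hM]
  field_simp

end Concentration

/-! ### Square loss regression -/

section Regression

lemma sqLoss_mem_Icc {X : Type*} {f : X → ℝ} {z : X × ℝ} {M₀ : ℝ} (hf : |f z.1| ≤ M₀) (hz : |z.2| ≤ M₀) :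
    sqLoss f z ∈ Set.Icc 0 (4 * M₀ ^ 2) := by
  refine ⟨sq_nonneg _, ?_⟩
  rw [abs_le] at hf hz
  rw [sqLoss, show 4 * M₀ ^ 2 = (2 * M₀) ^ 2 by ring]
  exact sq_le_sq' (by linarith) (by linarith)

variable {X : Type*} [MeasurableSpace X]

lemma abs_integral_mul_le_normL2_mul {Q : Measure X} {h g : X → ℝ}
    (hh : Integrable (fun x => h x * h x) Q) (hg : Integrable (fun x => g x * g x) Q)
    (hhg : Integrable (fun x => h x * g x) Q) :
    |∫ x, h x * g x ∂Q| ≤ normL2 Q h * normL2 Q g := by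
  have hA : 0 ≤ ∫ x, h x * h x ∂Q := integral_nonneg fun x => mul_self_nonneg _
  have key : ∀ c : ℝ, 0 ≤ (∫ x, g x * g x ∂Q) * (c * c) + (2 * ∫ x, h x * g x ∂Q) * c +
      ∫ x, h x * h x ∂Q := fun c => by
    have e : ∫ x, (h x + c * g x) ^ 2 ∂Q = (∫ x, g x * g x ∂Q) * (c * c) +
        (2 * ∫ x, h x * g x ∂Q) * c + ∫ x, h x * h x ∂Q := by
      have e1 : ∀ x, (h x + c * g x) ^ 2 =
          (c * c) * (g x * g x) + (2 * c) * (h x * g x) + h x * h x := fun x => by ring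
      have hI : Integrable (fun x => (c * c) * (g x * g x) + (2 * c) * (h x * g x)) Q :=
        (hg.const_mul _).add (hhg.const_mul _)
      simp_rw [e1]
      rw [integral_add hI hh, integral_add (hg.const_mul _) (hhg.const_mul _),
        integral_const_mul, integral_const_mul]
      ring
    rw [← e]
    exact integral_nonneg fun x => sq_nonneg _
  have hd := discrim_le_zero key
  rw [discrim] at hd
  rw [normL2, normL2, ← Real.sqrt_mul hA]
  refine Real.abs_le_sqrt ?_
  nlinarith

variable {P : Measure (X × ℝ)} {M₀ : ℝ}

lemma ae_of_ae_marginal {Q : Measure X} (hQ : P.map Prod.fst = Q) {p : X → Prop}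
    (h : ∀ᵐ x ∂Q, p x) : ∀ᵐ z ∂P, p z.1 := by
  rw [← hQ] at h
  exact ae_of_ae_map measurable_fst.aemeasurable h

lemma integral_comp_fst {Q : Measure X} (hQ : P.map Prod.fst = Q) {g : X → ℝ}
    (hg : Measurable g) : ∫ z, g z.1 ∂P = ∫ x, g x ∂Q := by
  rw [← hQ, integral_map measurable_fst.aemeasurable hg.aestronglyMeasurable]

variable [IsProbabilityMeasure P]

lemma measurable_regressionFn : Measurable (regressionFn P) :=
  (StronglyMeasurable.integral_kernel (κ := P.condKernel) (f := fun y : ℝ => y)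
    measurable_id.stronglyMeasurable).measurable

lemma ae_abs_regressionFn_le {Q : Measure X} (hQ : P.map Prod.fst = Q)
    (hP : ∀ᵐ z ∂P, |z.2| ≤ M₀) : ∀ᵐ x ∂Q, |regressionFn P x| ≤ M₀ := by
  rw [← P.disintegrate P.condKernel] at hP
  have h := Measure.ae_ae_of_ae_compProd hP
  have hQ' : P.fst = Q := hQ
  rw [hQ'] at h
  filter_upwards [h] with x hx
  have := norm_integral_le_of_norm_le_const (μ := P.condKernel x) (f := fun y => y) (C := M₀)
    (by simpa only [Real.norm_eq_abs] using hx)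
  simpa [regressionFn] using this

lemma ae_abs_mul_le {Z : Type*} [MeasurableSpace Z] {ν : Measure Z} {f g : Z → ℝ} {K K' : ℝ}
    (hf : ∀ᵐ z ∂ν, |f z| ≤ K) (hg : ∀ᵐ z ∂ν, |g z| ≤ K') : ∀ᵐ z ∂ν, |f z * g z| ≤ K * K' := by
  filter_upwards [hf, hg] with z h1 h2
  rw [abs_mul]
  exact mul_le_mul h1 h2 (abs_nonneg _) ((abs_nonneg _).trans h1)

lemma integrable_mul_of_ae_abs_le {Z : Type*} [MeasurableSpace Z] {ν : Measure Z}
    [IsFiniteMeasure ν] {f g : Z → ℝ} (hfm : Measurable f) (hgm : Measurable g) {K K' : ℝ}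
    (hf : ∀ᵐ z ∂ν, |f z| ≤ K) (hg : ∀ᵐ z ∂ν, |g z| ≤ K') :
    Integrable (fun z => f z * g z) ν :=
  integrable_of_ae_abs_le (hfm.mul hgm).aestronglyMeasurable (ae_abs_mul_le hf hg)

/-- The tower property: disintegrate `P` over its marginal and pull `g` out of the inner integral.
-/
lemma integral_fst_mul_snd {Q : Measure X} (hQ : P.map Prod.fst = Q)
    (hP : ∀ᵐ z ∂P, |z.2| ≤ M₀) {g : X → ℝ} (hg : Measurable g) {K : ℝ}
    (hgK : ∀ᵐ x ∂Q, |g x| ≤ K) :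
    ∫ z, g z.1 * z.2 ∂P = ∫ x, g x * regressionFn P x ∂Q := by
  have hint : Integrable (fun z : X × ℝ => g z.1 * z.2) P :=
    integrable_mul_of_ae_abs_le (hg.comp measurable_fst) measurable_snd
      (ae_of_ae_marginal hQ hgK) hP
  have h := Measure.integral_condKernel hint
  have hQ' : P.fst = Q := hQ
  rw [hQ'] at h
  rw [← h]
  exact integral_congr_ae (Filter.Eventually.of_forall fun x =>
    integral_const_mul (μ := P.condKernel x) (g x) fun y => y)

/-- The risk of a bounded function in terms of the regression function. -/
lemma risk_eq {Q : Measure X} (hQ : P.map Prod.fst = Q) (hP : ∀ᵐ z ∂P, |z.2| ≤ M₀) {f : X → ℝ}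
    (hf : Measurable f) (hfM : ∀ᵐ x ∂Q, |f x| ≤ M₀) :
    risk P f = ∫ x, f x * f x ∂Q - 2 * ∫ x, f x * regressionFn P x ∂Q + ∫ z, z.2 * z.2 ∂P := by
  have hfP := ae_of_ae_marginal hQ hfM
  have hf1 : Measurable fun z : X × ℝ => f z.1 := hf.comp measurable_fst
  have i1 : Integrable (fun z : X × ℝ => f z.1 * f z.1) P :=
    integrable_mul_of_ae_abs_le hf1 hf1 hfP hfP
  have i2 : Integrable (fun z : X × ℝ => f z.1 * z.2) P :=
    integrable_mul_of_ae_abs_le hf1 measurable_snd hfP hP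
  have i3 : Integrable (fun z : X × ℝ => z.2 * z.2) P :=
    integrable_mul_of_ae_abs_le measurable_snd measurable_snd hP hP
  have i4 : Integrable (fun z : X × ℝ => f z.1 * f z.1 - 2 * (f z.1 * z.2)) P :=
    i1.sub (i2.const_mul _)
  have e : ∀ z : X × ℝ, sqLoss f z = f z.1 * f z.1 - 2 * (f z.1 * z.2) + z.2 * z.2 := fun z => by
    rw [sqLoss]
    ring
  simp_rw [risk, e]
  rw [integral_add i4 i3, integral_sub i1 (i2.const_mul _), integral_const_mul,
    integral_fst_mul_snd hQ hP hf hfM, integral_comp_fst hQ (g := fun x => f x * f x) (hf.mul hf)]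

lemma normL2_nonneg {Q : Measure X} {h : X → ℝ} : 0 ≤ normL2 Q h := Real.sqrt_nonneg _

lemma sq_normL2 {Q : Measure X} {h : X → ℝ} : normL2 Q h ^ 2 = ∫ x, h x * h x ∂Q :=
  Real.sq_sqrt (integral_nonneg fun _ => mul_self_nonneg _)

lemma isProbabilityMeasure_marginal {Q : Measure X} (hQ : P.map Prod.fst = Q) :
    IsProbabilityMeasure Q := by
  rw [← hQ]
  exact Measure.isProbabilityMeasure_map measurable_fst.aemeasurable

lemma integral_sub_mul_sub {Q : Measure X} [IsFiniteMeasure Q] {f g : X → ℝ} (hf : Measurable f)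
    (hg : Measurable g) {K : ℝ} (hfK : ∀ᵐ x ∂Q, |f x| ≤ K) (hgK : ∀ᵐ x ∂Q, |g x| ≤ K) :
    ∫ x, (f x - g x) * (f x - g x) ∂Q =
      ∫ x, f x * f x ∂Q - 2 * ∫ x, f x * g x ∂Q + ∫ x, g x * g x ∂Q := by
  have i1 := integrable_mul_of_ae_abs_le hf hf hfK hfK
  have i2 := integrable_mul_of_ae_abs_le hf hg hfK hgK
  have i3 := integrable_mul_of_ae_abs_le hg hg hgK hgK
  have i4 : Integrable (fun x => f x * f x - 2 * (f x * g x)) Q := i1.sub (i2.const_mul _)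
  have e : ∀ x, (f x - g x) * (f x - g x) = f x * f x - 2 * (f x * g x) + g x * g x :=
    fun x => by ring
  simp_rw [e]
  rw [integral_add i4 i3, integral_sub i1 (i2.const_mul _), integral_const_mul]

/-- The excess risk is the squared `L²` distance to the regression function. -/
lemma risk_sub_risk_regressionFn {Q : Measure X} (hQ : P.map Prod.fst = Q)
    (hP : ∀ᵐ z ∂P, |z.2| ≤ M₀) {f : X → ℝ} (hf : Measurable f) (hfM : ∀ᵐ x ∂Q, |f x| ≤ M₀) :
    risk P f - risk P (regressionFn P) = normL2 Q (fun x => f x - regressionFn P x) ^ 2 := by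
  have := isProbabilityMeasure_marginal hQ
  have hr := ae_abs_regressionFn_le hQ hP
  rw [sq_normL2, risk_eq hQ hP hf hfM, risk_eq hQ hP measurable_regressionFn hr,
    integral_sub_mul_sub hf measurable_regressionFn hfM hr]
  ring

lemma measurable_sqLoss {f : X → ℝ} (hf : Measurable f) : Measurable (sqLoss f) :=
  ((hf.comp measurable_fst).sub measurable_snd).pow_const 2

lemma integrable_sqLoss {f : X → ℝ} (hf : Measurable f) (hfM : ∀ x, |f x| ≤ M₀)
    (hP : ∀ᵐ z ∂P, |z.2| ≤ M₀) : Integrable (sqLoss f) P := by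
  refine integrable_of_ae_abs_le (K := 4 * M₀ ^ 2) (measurable_sqLoss hf).aestronglyMeasurable ?_
  filter_upwards [hP] with z hz
  have := sqLoss_mem_Icc (hfM z.1) hz
  rw [abs_of_nonneg this.1]
  exact this.2

/-- Second moment of the loss difference. -/
lemma integral_sqLoss_sub_sq_le {Q : Measure X} (hQ : P.map Prod.fst = Q)
    (hP : ∀ᵐ z ∂P, |z.2| ≤ M₀) {f₁ f₂ : X → ℝ} (h₁ : Measurable f₁) (h₂ : Measurable f₂)
    (hb₁ : ∀ x, |f₁ x| ≤ M₀) (hb₂ : ∀ x, |f₂ x| ≤ M₀) :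
    ∫ z, (sqLoss f₁ z - sqLoss f₂ z) ^ 2 ∂P ≤
      16 * M₀ ^ 2 * normL2 Q (fun x => f₁ x - f₂ x) ^ 2 := by
  have hm : Measurable fun x => (f₁ x - f₂ x) * (f₁ x - f₂ x) := (h₁.sub h₂).mul (h₁.sub h₂)
  have hb : ∀ᵐ z ∂P, |f₁ z.1 - f₂ z.1| ≤ 2 * M₀ := Filter.Eventually.of_forall fun z => by
    have a1 := abs_le.1 (hb₁ z.1)
    have a2 := abs_le.1 (hb₂ z.1)
    exact abs_le.2 ⟨by linarith, by linarith⟩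
  have hd : Measurable fun z : X × ℝ => f₁ z.1 - f₂ z.1 := (h₁.sub h₂).comp measurable_fst
  rw [sq_normL2, ← integral_comp_fst hQ hm, ← integral_const_mul]
  refine integral_mono_ae ?_ ((integrable_mul_of_ae_abs_le hd hd hb hb).const_mul _) ?_
  · refine integrable_of_ae_abs_le (K := (4 * M₀ ^ 2) ^ 2)
      (((measurable_sqLoss h₁).sub (measurable_sqLoss h₂)).pow_const 2).aestronglyMeasurable ?_
    filter_upwards [hP] with z hz
    have a1 := sqLoss_mem_Icc (hb₁ z.1) hz
    have a2 := sqLoss_mem_Icc (hb₂ z.1) hz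
    rw [abs_pow]
    exact pow_le_pow_left₀ (abs_nonneg _)
      (abs_le.2 ⟨by linarith [a1.1, a2.2], by linarith [a1.2, a2.1]⟩) 2
  · filter_upwards [hP] with z hz
    have a1 := abs_le.1 (hb₁ z.1)
    have a2 := abs_le.1 (hb₂ z.1)
    have a3 := abs_le.1 hz
    have e : (sqLoss f₁ z - sqLoss f₂ z) ^ 2 =
        (f₁ z.1 + f₂ z.1 - 2 * z.2) ^ 2 * ((f₁ z.1 - f₂ z.1) * (f₁ z.1 - f₂ z.1)) := by
      rw [sqLoss, sqLoss]
      ring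
    rw [e]
    refine mul_le_mul_of_nonneg_right ?_ (mul_self_nonneg _)
    rw [show 16 * M₀ ^ 2 = (4 * M₀) ^ 2 by ring]
    exact sq_le_sq' (by linarith) (by linarith)

/-- The means of the loss difference under two distributions with the same covariate marginal. -/
lemma abs_risk_diff_sub_le {P' : Measure (X × ℝ)} [IsProbabilityMeasure P'] {Q : Measure X}
    (hQ : P.map Prod.fst = Q) (hQ' : P'.map Prod.fst = Q) (hP : ∀ᵐ z ∂P, |z.2| ≤ M₀)
    (hP' : ∀ᵐ z ∂P', |z.2| ≤ M₀) {f₁ f₂ : X → ℝ} (h₁ : Measurable f₁) (h₂ : Measurable f₂)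
    (hb₁ : ∀ x, |f₁ x| ≤ M₀) (hb₂ : ∀ x, |f₂ x| ≤ M₀) :
    |(risk P f₁ - risk P f₂) - (risk P' f₁ - risk P' f₂)| ≤
      2 * (normL2 Q (fun x => f₁ x - f₂ x) *
        normL2 Q (fun x => regressionFn P x - regressionFn P' x)) := by
  have := isProbabilityMeasure_marginal hQ
  have b1 : ∀ᵐ x ∂Q, |f₁ x| ≤ M₀ := Filter.Eventually.of_forall hb₁
  have b2 : ∀ᵐ x ∂Q, |f₂ x| ≤ M₀ := Filter.Eventually.of_forall hb₂
  have r := ae_abs_regressionFn_le hQ hP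
  have r' := ae_abs_regressionFn_le hQ' hP'
  have m := measurable_regressionFn (P := P)
  have m' := measurable_regressionFn (P := P')
  have bh : ∀ᵐ x ∂Q, |f₁ x - f₂ x| ≤ 2 * M₀ := by
    filter_upwards [b1, b2] with x h h'
    rw [abs_le] at *
    constructor <;> linarith [h.1, h.2, h'.1, h'.2]
  have bg : ∀ᵐ x ∂Q, |regressionFn P x - regressionFn P' x| ≤ 2 * M₀ := by
    filter_upwards [r, r'] with x h h'
    rw [abs_le] at *
    constructor <;> linarith [h.1, h.2, h'.1, h'.2]
  -- The terms in `y²` cancel within each difference, and those in `f₁²`, `f₂²` cancel because both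
  -- marginals are `Q`. Only the cross term remains.
  have e : (risk P f₁ - risk P f₂) - (risk P' f₁ - risk P' f₂) =
      -2 * ∫ x, (f₁ x - f₂ x) * (regressionFn P x - regressionFn P' x) ∂Q := by
    have e1 : ∀ x, (f₁ x - f₂ x) * (regressionFn P x - regressionFn P' x) =
        (f₁ x * regressionFn P x - f₂ x * regressionFn P x) -
          (f₁ x * regressionFn P' x - f₂ x * regressionFn P' x) := fun x => by ring
    have i1 := integrable_mul_of_ae_abs_le h₁ m b1 r
    have i2 := integrable_mul_of_ae_abs_le h₂ m b2 r
    have i3 := integrable_mul_of_ae_abs_le h₁ m' b1 r'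
    have i4 := integrable_mul_of_ae_abs_le h₂ m' b2 r'
    have i5 : Integrable (fun x => f₁ x * regressionFn P x - f₂ x * regressionFn P x) Q :=
      i1.sub i2
    have i6 : Integrable (fun x => f₁ x * regressionFn P' x - f₂ x * regressionFn P' x) Q :=
      i3.sub i4
    simp_rw [e1]
    rw [integral_sub i5 i6, integral_sub i1 i2, integral_sub i3 i4, risk_eq hQ hP h₁ b1,
      risk_eq hQ hP h₂ b2, risk_eq hQ' hP' h₁ b1, risk_eq hQ' hP' h₂ b2]
    ring
  rw [e, abs_mul, abs_neg, abs_two]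
  gcongr
  exact abs_integral_mul_le_normL2_mul
    (integrable_mul_of_ae_abs_le (h₁.sub h₂) (h₁.sub h₂) bh bh)
    (integrable_mul_of_ae_abs_le (m.sub m') (m.sub m') bg bg)
    (integrable_mul_of_ae_abs_le (h₁.sub h₂) (m.sub m') bh bg)

/-- A triangle inequality with a lossy factor `2`, which follows from the pointwise `(a - b)² ≤ 2a²
+ 2b²`. -/
lemma normL2_sub_le {Q : Measure X} [IsFiniteMeasure Q] {f₁ f₂ r : X → ℝ} (h₁ : Measurable f₁)
    (h₂ : Measurable f₂) (hr : Measurable r) {K : ℝ} (b₁ : ∀ᵐ x ∂Q, |f₁ x| ≤ K)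
    (b₂ : ∀ᵐ x ∂Q, |f₂ x| ≤ K) (br : ∀ᵐ x ∂Q, |r x| ≤ K) :
    normL2 Q (fun x => f₁ x - f₂ x) ≤
      2 * (normL2 Q (fun x => f₁ x - r x) + normL2 Q (fun x => f₂ x - r x)) := by
  have hb : ∀ {f g : X → ℝ}, (∀ᵐ x ∂Q, |f x| ≤ K) → (∀ᵐ x ∂Q, |g x| ≤ K) →
      ∀ᵐ x ∂Q, |f x - g x| ≤ 2 * K := fun hf hg => by
    filter_upwards [hf, hg] with x h h'
    rw [abs_le] at *
    constructor <;> linarith [h.1, h.2, h'.1, h'.2]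
  have hi : ∀ {f g : X → ℝ}, Measurable f → Measurable g → (∀ᵐ x ∂Q, |f x| ≤ K) →
      (∀ᵐ x ∂Q, |g x| ≤ K) → Integrable (fun x => (f x - g x) * (f x - g x)) Q :=
    fun hf hg bf bg =>
      integrable_mul_of_ae_abs_le (hf.sub hg) (hf.sub hg) (hb bf bg) (hb bf bg)
  have i := hi h₁ h₂ b₁ b₂
  have i₁ := hi h₁ hr b₁ br
  have i₂ := hi h₂ hr b₂ br
  have n₁ := normL2_nonneg (Q := Q) (h := fun x => f₁ x - r x)
  have n₂ := normL2_nonneg (Q := Q) (h := fun x => f₂ x - r x)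
  have key : normL2 Q (fun x => f₁ x - f₂ x) ^ 2 ≤
      2 * normL2 Q (fun x => f₁ x - r x) ^ 2 + 2 * normL2 Q (fun x => f₂ x - r x) ^ 2 := by
    rw [sq_normL2, sq_normL2, sq_normL2, ← integral_const_mul, ← integral_const_mul,
      ← integral_add (i₁.const_mul _) (i₂.const_mul _)]
    refine integral_mono i ((i₁.const_mul _).add (i₂.const_mul _)) fun x => ?_
    simp only
    nlinarith [sq_nonneg (f₁ x - r x + (f₂ x - r x))]
  refine le_of_sq_le_sq ?_ (by positivity)
  nlinarith [mul_nonneg n₁ n₂]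

end Regression

/-! ### Fast rate for the comparison of two models -/

/-- If `d - e > 264R` then `R ≤ d + e`, so the right side of `h` is at most `(72 + 192)(d + e)R`;
factoring `d² - e²` gives a contradiction. -/
lemma sub_min_le_and_sq_le {d e R : ℝ} (hd : 0 ≤ d) (he : 0 ≤ e) (hR : 0 ≤ R)
    (h : d ^ 2 - e ^ 2 ≤ 72 * ((d + e) * R) + 192 * R ^ 2) :
    d - min d e ≤ 264 * R ∧ d ^ 2 ≤ 2 * min (d ^ 2) (e ^ 2) + 2 * (264 * R) ^ 2 := by
  have h1 : d - e ≤ 264 * R := by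
    by_contra! hc
    have h2 : R ≤ d + e := by linarith
    have h3 : 0 ≤ R * (d + e - R) := mul_nonneg hR (by linarith)
    have h4 : (d + e) * (264 * R) < (d + e) * (d - e) :=
      mul_lt_mul_of_pos_left hc (by linarith)
    nlinarith
  constructor
  · rcases min_cases d e with ⟨hm, _⟩ | ⟨hm, _⟩ <;> rw [hm]
    · linarith
    · exact h1
  · rcases min_cases (d ^ 2) (e ^ 2) with ⟨hm, _⟩ | ⟨hm, _⟩ <;> rw [hm]
    · nlinarith [sq_nonneg (264 * R)]
    · have h5 : d ^ 2 ≤ (e + 264 * R) ^ 2 := pow_le_pow_left₀ hd (by linarith) 2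
      nlinarith [sq_nonneg (e - 264 * R)]

/-- The oracle inequality with bias `b = 2HA` gives `10HA + 36√a M₀H + 192aM₀²`. Then `H ≤ 2(d + e)`
turns `36` into `72`. -/
lemma abs_windowMean_sub_le_of_variance_bound {B : ℕ → ℕ} {u : ℕ → ℕ → ℝ} {M₀ δ : ℝ}
    {t khat k : ℕ} (hM : 0 ≤ M₀) (hkhat : IsAdaptiveWindow B u (8 * M₀ ^ 2) δ t khat)
    (hk : k ∈ Set.Icc 1 t) {m : ℕ → ℝ} {θ A H a d e : ℝ} (hA : 0 ≤ A) (hH : 0 ≤ H) (ha : 0 ≤ a)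
    (hHd : H ≤ 2 * (d + e))
    (hm : ∀ i ∈ Set.Icc 1 t, |windowMean B u t i - m i| ≤ psiHat B u (8 * M₀ ^ 2) δ t i)
    (hψ : psiHat B u (8 * M₀ ^ 2) δ t k ≤
      3 * (√a * √(16 * M₀ ^ 2 * H ^ 2)) + 8 * (a * (8 * M₀ ^ 2)))
    (hb : ∀ i ∈ Set.Icc 1 k, |m i - θ| ≤ 2 * (H * A)) :
    |windowMean B u t khat - θ| ≤
      72 * ((d + e) * (A + √a * M₀)) + 192 * (A + √a * M₀) ^ 2 := by
  have h := abs_windowMean_sub_le hkhat hk hm hb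
  have e1 : √(16 * M₀ ^ 2 * H ^ 2) = 4 * M₀ * H := by
    rw [show 16 * M₀ ^ 2 * H ^ 2 = (4 * M₀ * H) ^ 2 by ring]
    exact Real.sqrt_sq (by positivity)
  rw [e1] at hψ
  have e2 := Real.sq_sqrt ha
  have hs := Real.sqrt_nonneg a
  generalize √a = s at *
  subst e2
  have e3 : 0 ≤ H * A := mul_nonneg hH hA
  have e4 : 0 ≤ A * (s * M₀) := by positivity
  have e5 : H * (A + s * M₀) ≤ 2 * (d + e) * (A + s * M₀) := by gcongr
  nlinarith [sq_nonneg A]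

/-- The weighted mean of values close to `θ` over a window is close to `θ`. -/
lemma abs_weighted_mean_sub_le {B : ℕ → ℕ} {t k : ℕ} (hn : 1 ≤ windowSize B t k) {e : ℕ → ℝ}
    {θ b : ℝ} (h : ∀ j ∈ Finset.Icc (t - k + 1) t, |e j - θ| ≤ b) :
    |(∑ j ∈ Finset.Icc (t - k + 1) t, (B j : ℝ) * e j) / windowSize B t k - θ| ≤ b := by
  have hn0 : (0 : ℝ) < windowSize B t k := by exact_mod_cast hn
  have hc : (windowSize B t k : ℝ) = ∑ j ∈ Finset.Icc (t - k + 1) t, (B j : ℝ) := by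
    rw [windowSize]
    push_cast
    rfl
  have e1 : (∑ j ∈ Finset.Icc (t - k + 1) t, (B j : ℝ) * e j) / windowSize B t k - θ =
      (∑ j ∈ Finset.Icc (t - k + 1) t, (B j : ℝ) * (e j - θ)) / windowSize B t k := by
    simp_rw [mul_sub]
    rw [Finset.sum_sub_distrib, ← Finset.sum_mul, ← hc]
    field_simp
  rw [e1, abs_div, abs_of_pos hn0, div_le_iff₀ hn0, mul_comm b, hc, Finset.sum_mul]
  refine (Finset.abs_sum_le_sum_abs _ _).trans (Finset.sum_le_sum fun j hj => ?_)
  rw [abs_mul, Nat.abs_cast]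
  exact mul_le_mul_of_nonneg_left (h j hj) (Nat.cast_nonneg _)

end RollingWindow

/-! ### The main theorem: the good event and the choice of constants. -/

open RollingWindow

theorem mainTheorem3 :
    ∃ C : ℝ, 0 < C ∧
      ∀ (X : Type*) [MeasurableSpace X]
        -- the distributions `P 1, P 2, …` of `(x, y)`; the index `0` is not used
        (P : ℕ → Measure (X × ℝ)) [∀ j, IsProbabilityMeasure (P j)]
        (M₀ : ℝ) (_ : 0 < M₀)
        -- bounded responses
        (_ : ∀ j, 1 ≤ j → ∀ᵐ z ∂(P j), |z.2| ≤ M₀)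
        -- no covariate shift: `Q` is the common marginal distribution of the covariate
        (Q : Measure X) (_ : ∀ j, 1 ≤ j → (P j).map Prod.fst = Q)
        -- the two bounded candidate models
        (f₁ f₂ : X → ℝ) (_ : Measurable f₁) (_ : Measurable f₂)
        (_ : ∀ x, |f₁ x| ≤ M₀) (_ : ∀ x, |f₂ x| ≤ M₀)
        -- current time and batch sizes
        (t : ℕ) (_ : 1 ≤ t) (B : ℕ → ℕ) (_ : ∀ j, 1 ≤ j → 1 ≤ B j)
        -- independent samples `z j i ∼ P j` for `1 ≤ j ≤ t`, `1 ≤ i ≤ B j`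
        (Ω : Type*) [MeasurableSpace Ω] (μ : Measure Ω) [IsProbabilityMeasure μ]
        (z : ℕ → ℕ → Ω → X × ℝ)
        (_ : ∀ j ∈ Set.Icc 1 t, ∀ i ∈ Set.Icc 1 (B j), Measurable (z j i) ∧ μ.map (z j i) = P j)
        (_ : iIndepFun
          (fun p : {p : ℕ × ℕ // p.1 ∈ Set.Icc 1 t ∧ p.2 ∈ Set.Icc 1 (B p.1)} =>
            z p.1.1 p.1.2) μ)
        (δ : ℝ) (_ : δ ∈ Set.Ioo (0 : ℝ) 1),
        1 - δ ≤ μ.real {ω | ∀ fhat : X → ℝ,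
          RollingWindow.IsComparisonOutput f₁ f₂ B (fun j i => z j i ω)
              (8 * M₀ ^ 2) (δ / (3 * (t : ℝ))) t fhat →
            RollingWindow.normL2 Q (fun x => fhat x - RollingWindow.regressionFn (P t) x) -
                min (RollingWindow.normL2 Q (fun x => f₁ x - RollingWindow.regressionFn (P t) x))
                  (RollingWindow.normL2 Q (fun x => f₂ x - RollingWindow.regressionFn (P t) x))
              ≤ C * √(Real.log (6 * (t : ℝ) / δ)) *
                ⨅ k : Set.Icc 1 t, (RollingWindow.maxShift P Q t k +
                  M₀ / √(RollingWindow.windowSize B t k : ℝ)) ∧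
            RollingWindow.risk (P t) fhat -
                RollingWindow.risk (P t) (RollingWindow.regressionFn (P t))
              ≤ 2 * min
                  (RollingWindow.risk (P t) f₁ -
                    RollingWindow.risk (P t) (RollingWindow.regressionFn (P t)))
                  (RollingWindow.risk (P t) f₂ -
                    RollingWindow.risk (P t) (RollingWindow.regressionFn (P t))) +
                C * Real.log (6 * (t : ℝ) / δ) *
                  ⨅ k : Set.Icc 1 t, (RollingWindow.maxShift P Q t k ^ 2 +
                    M₀ ^ 2 / (RollingWindow.windowSize B t k : ℝ))} := by
  -- The excess risk needs `4 * 264² = 278784`; the norm bound needs only `264`.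
  refine ⟨300000, by norm_num, ?_⟩
  intro X _ P _ M₀ hM₀ hP Q hQ f₁ f₂ hf₁ hf₂ hb₁ hb₂ t ht B hB Ω _ μ _ z hz hind δ hδ
  have hδ0 := hδ.1
  have ht0 : (0 : ℝ) < t := by exact_mod_cast ht
  have ht1 : (1 : ℝ) ≤ t := by exact_mod_cast ht
  have hQ1 := isProbabilityMeasure_marginal (hQ 1 le_rfl)
  set δ' := δ / (3 * (t : ℝ)) with hδ'
  have hlog : Real.log (6 * (t : ℝ) / δ) = Real.log (2 / δ') := by
    congr 1
    rw [hδ']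
    field_simp
    norm_num
  rw [hlog]
  set l := Real.log (2 / δ') with hl
  have hexp : Real.exp (-l) = δ / (6 * t) := by
    rw [Real.exp_neg, hl, Real.exp_log (by positivity), hδ']
    field_simp
    norm_num
  have hl1 : 1 ≤ l := by
    rw [← hlog, Real.le_log_iff_exp_le (by positivity), le_div_iff₀ hδ0]
    have := Real.exp_one_lt_d9
    nlinarith [hδ.2]
  -- population quantities
  set d₁ := normL2 Q (fun x => f₁ x - regressionFn (P t) x) with hd₁
  set d₂ := normL2 Q (fun x => f₂ x - regressionFn (P t) x) with hd₂
  have hd₁0 : 0 ≤ d₁ := normL2_nonneg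
  have hd₂0 : 0 ≤ d₂ := normL2_nonneg
  set H := normL2 Q (fun x => f₁ x - f₂ x) with hH
  have ab₁ : ∀ᵐ x ∂Q, |f₁ x| ≤ M₀ := Filter.Eventually.of_forall hb₁
  have ab₂ : ∀ᵐ x ∂Q, |f₂ x| ≤ M₀ := Filter.Eventually.of_forall hb₂
  have hHd : H ≤ 2 * (d₁ + d₂) := normL2_sub_le hf₁ hf₂ measurable_regressionFn ab₁ ab₂
    (ae_abs_regressionFn_le (hQ t ht) (hP t ht))
  have hr₁ := risk_sub_risk_regressionFn (hQ t ht) (hP t ht) hf₁ ab₁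
  have hr₂ := risk_sub_risk_regressionFn (hQ t ht) (hP t ht) hf₂ ab₂
  set e : ℕ → ℝ := fun j => risk (P j) f₁ - risk (P j) f₂ with he
  have hθ : e t = d₁ ^ 2 - d₂ ^ 2 := by
    simp only [he]
    linarith
  have hshift : ∀ k, ∀ j ∈ Set.Icc (t - k + 1) t,
      normL2 Q (fun x => regressionFn (P j) x - regressionFn (P t) x) ≤ maxShift P Q t k :=
    fun k j hj => le_ciSup (f := fun j : Set.Icc (t - k + 1) t =>
      normL2 Q (fun x => regressionFn (P j) x - regressionFn (P t) x))
      (Set.finite_range _).bddAbove ⟨j, hj⟩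
  have hshift0 : ∀ k, 0 ≤ maxShift P Q t k := fun k => Real.iSup_nonneg fun j => normL2_nonneg
  set m : ℕ → ℝ := fun k =>
    (∑ j ∈ Finset.Icc (t - k + 1) t, (B j : ℝ) * e j) / windowSize B t k with hm
  have hbias : ∀ k ∈ Set.Icc 1 t, ∀ i ∈ Set.Icc 1 k,
      |m i - e t| ≤ 2 * (H * maxShift P Q t k) := fun k hk i hi => by
    -- Windows are nested, so the shift over window `k` controls the bias of every shorter window
    -- `i`.
    refine abs_weighted_mean_sub_le (windowSize_pos hB ⟨hi.1, hi.2.trans hk.2⟩) fun j hj => ?_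
    rw [Finset.mem_Icc] at hj
    have hik := hi.2
    refine (abs_risk_diff_sub_le (hQ j (by omega)) (hQ t ht) (hP j (by omega)) (hP t ht)
      hf₁ hf₂ hb₁ hb₂).trans ?_
    have := hshift k j ⟨by omega, hj.2⟩
    have : 0 ≤ H := normL2_nonneg
    gcongr
  -- the good event
  set u : ℕ → ℕ → Ω → ℝ := fun j i ω => sqLoss f₁ (z j i ω) - sqLoss f₂ (z j i ω) with hu
  have hgm : Measurable fun w : X × ℝ => sqLoss f₁ w - sqLoss f₂ w :=
    (measurable_sqLoss hf₁).sub (measurable_sqLoss hf₂)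
  have hlaw : ∀ j ∈ Set.Icc 1 t, ∀ i ∈ Set.Icc 1 (B j), ∀ g : X × ℝ → ℝ, Measurable g →
      ∫ ω, g (z j i ω) ∂μ = ∫ w, g w ∂(P j) := fun j hj i hi g hg => by
    obtain ⟨h1, h2⟩ := hz j hj i hi
    rw [← h2, integral_map h1.aemeasurable hg.aestronglyMeasurable]
  have hconc : ∀ k ∈ Set.Icc 1 t, μ.real {ω | ¬ (|windowMean B (fun j i => u j i ω) t k - m k| ≤
        psiHat B (fun j i => u j i ω) (8 * M₀ ^ 2) δ' t k ∧
      psiHat B (fun j i => u j i ω) (8 * M₀ ^ 2) δ' t k ≤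
        3 * (√(l / windowSize B t k) * √(16 * M₀ ^ 2 * H ^ 2)) +
          8 * (l / windowSize B t k * (8 * M₀ ^ 2)))} ≤ 4 * Real.exp (-l) := fun k hk => by
    refine measureReal_window_le (u := u) (e := e) hB hk
      (fun j hj i hi => hgm.comp (hz j hj i hi).1)
      (hind.comp (fun _ w => sqLoss f₁ w - sqLoss f₂ w) fun _ => hgm) (lo := -(4 * M₀ ^ 2))
      (by positivity) (fun j hj i hi => ?_) (fun j hj i hi => ?_) (fun j hj i hi => ?_) hl1 ?_
    · have h := hP j hj.1
      rw [← (hz j hj i hi).2] at h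
      filter_upwards [ae_of_ae_map (hz j hj i hi).1.aemeasurable h] with ω hω
      have a1 := sqLoss_mem_Icc (hb₁ (z j i ω).1) hω
      have a2 := sqLoss_mem_Icc (hb₂ (z j i ω).1) hω
      constructor <;> simp only [hu] <;> linarith [a1.1, a1.2, a2.1, a2.2]
    · rw [hlaw j hj i hi _ hgm, integral_sub (integrable_sqLoss hf₁ hb₁ (hP j hj.1))
        (integrable_sqLoss hf₂ hb₂ (hP j hj.1))]
      rfl
    · rw [hlaw j hj i hi _ (hgm.pow_const 2)]
      exact integral_sqLoss_sub_sq_le (hQ j hj.1) (hP j hj.1) hf₁ hf₂ hb₁ hb₂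
    · have : (windowSize B t k : ℝ) ≠ 0 := by
        have := windowSize_pos hB hk
        exact_mod_cast (by omega : windowSize B t k ≠ 0)
      simp only [hm]
      rw [mul_div_assoc', mul_div_cancel_left₀ _ this]
  set bad : ℕ → Set Ω := fun k => {ω | ¬ (|windowMean B (fun j i => u j i ω) t k - m k| ≤
        psiHat B (fun j i => u j i ω) (8 * M₀ ^ 2) δ' t k ∧
      psiHat B (fun j i => u j i ω) (8 * M₀ ^ 2) δ' t k ≤
        3 * (√(l / windowSize B t k) * √(16 * M₀ ^ 2 * H ^ 2)) +
          8 * (l / windowSize B t k * (8 * M₀ ^ 2)))} with hbad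
  -- Each of the `t` windows costs `4 exp(-l) = 2δ/(3t)`, in total `2δ/3`.
  have hbadle : μ.real (⋃ k ∈ Finset.Icc 1 t, bad k) ≤ δ := by
    refine (measureReal_biUnion_finset_le _ _).trans ?_
    refine (Finset.sum_le_sum (g := fun _ => 4 * Real.exp (-l)) fun k hk =>
      hconc k (Finset.mem_Icc.1 hk)).trans ?_
    rw [Finset.sum_const, Nat.card_Icc, hexp, nsmul_eq_mul, Nat.add_sub_cancel]
    have : (t : ℝ) * (4 * (δ / (6 * t))) = 2 / 3 * δ := by field_simp; norm_num
    rw [this]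
    linarith
  -- Subadditivity alone is used, so the event in the theorem, quantified over all `fhat`, need not
  -- be measurable.
  have hone : ∀ S : Set Ω, (⋃ k ∈ Finset.Icc 1 t, bad k)ᶜ ⊆ S → 1 - δ ≤ μ.real S := by
    intro S hS
    have h1 : (Set.univ : Set Ω) ⊆ S ∪ ⋃ k ∈ Finset.Icc 1 t, bad k := fun ω _ => by
      by_cases h : ω ∈ ⋃ k ∈ Finset.Icc 1 t, bad k
      · exact Or.inr h
      · exact Or.inl (hS h)
    have h2 := (measureReal_mono (μ := μ) h1).trans (measureReal_union_le _ _)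
    rw [probReal_univ] at h2
    linarith
  refine hone _ fun ω hω => ?_
  simp only [Set.mem_compl_iff, Set.mem_iUnion, not_exists, hbad, Set.mem_ofPred_eq, not_not,
    Finset.mem_Icc] at hω
  intro fhat hfhat
  obtain ⟨khat, hkhat, hcase⟩ := hfhat
  have hwin : ∀ k ∈ Set.Icc 1 t, |windowMean B (fun j i => u j i ω) t khat - e t| ≤
      72 * ((d₁ + d₂) * (maxShift P Q t k + √(l / windowSize B t k) * M₀)) +
        192 * (maxShift P Q t k + √(l / windowSize B t k) * M₀) ^ 2 := fun k hk =>
    abs_windowMean_sub_le_of_variance_bound hM₀.le hkhat hk (hshift0 k) normL2_nonneg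
      (by positivity) hHd (fun i hi => (hω i hi).1) (hω k hk).2 (hbias k hk)
  have hmain : ∀ k ∈ Set.Icc 1 t,
      normL2 Q (fun x => fhat x - regressionFn (P t) x) - min d₁ d₂ ≤
        264 * (maxShift P Q t k + √(l / windowSize B t k) * M₀) ∧
      risk (P t) fhat - risk (P t) (regressionFn (P t)) ≤ 2 * min (d₁ ^ 2) (d₂ ^ 2) +
        2 * (264 * (maxShift P Q t k + √(l / windowSize B t k) * M₀)) ^ 2 := fun k hk => by
    have h := hwin k hk
    have hR : 0 ≤ maxShift P Q t k + √(l / windowSize B t k) * M₀ :=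
      add_nonneg (hshift0 k) (by positivity)
    rw [hθ, abs_le] at h
    -- The sign of the estimate bounds `d₁² - d₂²`, or its negative, by the estimation error; the
    -- second case exchanges the two models.
    rcases hcase with ⟨hs, rfl⟩ | ⟨hs, rfl⟩
    · rw [hr₁]
      exact sub_min_le_and_sq_le hd₁0 hd₂0 hR (by linarith [h.1])
    · rw [hr₂, min_comm d₁, min_comm (d₁ ^ 2)]
      exact sub_min_le_and_sq_le hd₂0 hd₁0 hR (by rw [add_comm d₂]; linarith [h.2])
  have hne : Nonempty (Set.Icc 1 t) := ⟨⟨1, le_rfl, ht⟩⟩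
  rw [hr₁, hr₂]
  constructor
  · obtain ⟨k, hk⟩ := exists_eq_ciInf_of_finite (f := fun k : Set.Icc 1 t =>
      maxShift P Q t k + M₀ / √(windowSize B t k : ℝ))
    rw [← hk]
    refine (hmain k k.2).1.trans ?_
    have h0 := hshift0 k
    have hsl : 1 ≤ √l := Real.one_le_sqrt.2 hl1
    have e1 : √(l / windowSize B t k) * M₀ = √l * (M₀ / √(windowSize B t k : ℝ)) := by
      rw [Real.sqrt_div (by linarith)]
      ring
    rw [e1]
    have e2 : 0 ≤ √l * (M₀ / √(windowSize B t k : ℝ)) := by positivity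
    nlinarith [mul_nonneg (sub_nonneg.2 hsl) h0]
  · obtain ⟨k, hk⟩ := exists_eq_ciInf_of_finite (f := fun k : Set.Icc 1 t =>
      maxShift P Q t k ^ 2 + M₀ ^ 2 / (windowSize B t k : ℝ))
    rw [← hk]
    refine (hmain k k.2).2.trans ?_
    have e1 : (√(l / windowSize B t k) * M₀) ^ 2 = l * (M₀ ^ 2 / (windowSize B t k : ℝ)) := by
      rw [mul_pow, Real.sq_sqrt (by positivity)]
      ring
    have e2 : 0 ≤ l * (M₀ ^ 2 / (windowSize B t k : ℝ)) := by positivity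
    nlinarith [sq_nonneg (maxShift P Q t k - √(l / windowSize B t k) * M₀),
      mul_nonneg (sub_nonneg.2 hl1) (sq_nonneg (maxShift P Q t k))]
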